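/- Let $S^4\subset\mathbb{R}^5$ be the unit sphere and let $\Lambda^2_-S^4$ be the bundle of anti-self-dual $2$-forms over $S^4$. For $\lambda>0$ it carries the Bryant--Salamon torsion-free $G_2$-structure $\varphi_\lambda$: in terms of a local oriented orthonormal coframe $\{e^i\}$ of $S^4$, the frame $\omega_1=e^{12}-e^{34}$, $\omega_2=e^{13}-e^{42}$, $\omega_3=e^{14}-e^{23}$ of $\Lambda^2_-S^4$, the fibre coordinates $(a_1,a_2,a_3)$ it induces, and the vertical $1$-forms $b_i$ given by the Levi-Civita connection, $$\varphi_\lambda=2s_\lambda\sum_{i=1}^3 b_i\wedge\pi^*\omega_i+s_\lambda^{-3}\,b_1\wedge b_2\wedge b_3,\qquad s_\lambda=(\lambda+a_1^2+a_2^2+a_3^2)^{1/4}.$$ For $x_5\ne\pm1$ use the orthonormal frame of $S^4$ given by $$\tfrac{1}{\sqrt{1-x_5^2}}\{(-x_2,x_1,-x_4,x_3,0),\,(-x_3,x_4,x_1,-x_2,0),\,(-x_4,-x_3,x_2,x_1,0),\,(-x_1x_5,-x_2x_5,-x_3x_5,-x_4x_5,1-x_5^2)\},$$ and at $(0,0,0,0,\pm1)$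 the frame given by the first three standard basis vectors and $\pm$ the fourth. Let $SO(3)=SO(3)\times\{I_2\}\subset SO(5)$ act on $\Lambda^2_-S^4$ by the lift of its action on $S^4$. For $C,D\ge0$ and $E\in\mathbb{R}$ put $$M_{C,D,E}=SO(3)\cdot\left\{\big((x_1,0,0,x_4,x_5),(a_1,a_2,0)\big):\ x\in S^4,\ x_4^4(\lambda+r^2)=C,\ x_5^4(\lambda+r^2)=D,\ a_1x_1=E\right\},\quad r^2=a_1^2+a_2^2 .$$ Orient the regular part of $M_{C,D,E}$ (which is coassociative) by $*\varphi_\lambda$. A sequence of such sets $M_j$ converges to $M$ in the sense of currents if $\int_{M_j}\alpha\to\int_M\alpha$ for every compactly supported smooth $4$-form $\alpha$ on $\Lambda^2_-S^4$; sets of $4$-dimensional measure zero, such as the singular points, are disregarded. **Lemma.** Let $\lambda>0$. (1) Let $C_j,D_j>0$ with $C_j\to C_\infty>0$ and $D_j\to D_\infty>0$, where $\sqrt{C_\infty}+\sqrt{D_\infty}=\sqrt\lambda$. Suppose that either $\sqrt{C_j}+\sqrt{D_j}<\sqrt\lambda$ for all $j$, or $\sqrt{C_j}+\sqrt{D_j}>\sqrt\lambda$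 for all $j$. Then $M_{C_j,D_j,0}$ converges to $M_{C_\infty,D_\infty,0}$ in the sense of currents. (2) Let $C_j>0$ with $C_j\to C_\infty$, where $\sqrt{C_\infty}=\sqrt\lambda$. Suppose that either $\sqrt{C_j}<\sqrt\lambda$ for all $j$, or $\sqrt{C_j}>\sqrt\lambda$ for all $j$. Then $M_{C_j,0,0}$ converges to $M_{C_\infty,0,0}$, and $M_{0,C_j,0}$ converges to $M_{0,C_\infty,0}$, in the sense of currents. -/

import Mathlib

open Filter Topology MeasureTheory
open scoped ContDiff

namespace CoassocSO3

noncomputable section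

/-- The Euclidean space `ℝ⁵ × (5 × 5 real matrices)`. The bundle `Λ²₋S⁴` is the closed embedded
`7`-dimensional submanifold of the pairs `(x, A)` with `x ∈ S⁴` and `A` the matrix
`A i j = ω (e_i, e_j)` of an anti-self-dual `2`-form `ω` on `T_x S⁴`, extended by `ω (x, ·) = 0`. -/
abbrev Amb : Type := (Fin 5 → ℝ) × (Fin 5 → Fin 5 → ℝ)

/-- The oriented orthonormal frame `e₁, …, e₄` of `T_x S⁴` for `x₅ ≠ ± 1`, completed at the two
poles `x₅ = ± 1` by the basis `f₁, …, f₄` of the tangent space. -/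
def frame (x : Fin 5 → ℝ) : Fin 4 → Fin 5 → ℝ :=
  if x 4 ^ 2 = 1 then
    ![![1, 0, 0, 0, 0], ![0, 1, 0, 0, 0], ![0, 0, 1, 0, 0], ![0, 0, 0, x 4, 0]]
  else
    (√(1 - x 4 ^ 2))⁻¹ •
      ![![-x 1, x 0, -x 3, x 2, 0],
        ![-x 2, x 3, x 0, -x 1, 0],
        ![-x 3, -x 2, x 1, x 0, 0],
        ![-x 0 * x 4, -x 1 * x 4, -x 2 * x 4, -x 3 * x 4, 1 - x 4 ^ 2]]

/-- The matrix of the wedge product of the covectors dual to `u` and `v`. -/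
def wedgeMat (u v : Fin 5 → ℝ) : Fin 5 → Fin 5 → ℝ := fun i j => u i * v j - v i * u j

/-- The frame `ω₁ = e¹² - e³⁴, ω₂ = e¹³ - e⁴², ω₃ = e¹⁴ - e²³` of `Λ²₋S⁴` over `x`. -/
def asdFrame (x : Fin 5 → ℝ) : Fin 3 → Fin 5 → Fin 5 → ℝ :=
  ![wedgeMat (frame x 0) (frame x 1) - wedgeMat (frame x 2) (frame x 3),
    wedgeMat (frame x 0) (frame x 2) - wedgeMat (frame x 3) (frame x 1),
    wedgeMat (frame x 0) (frame x 3) - wedgeMat (frame x 1) (frame x 2)]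

/-- The point of `Λ²₋S⁴` over `x ∈ S⁴` with fibre coordinates `a = (a₁, a₂, a₃)`. -/
def bundlePoint (x : Fin 5 → ℝ) (a : Fin 3 → ℝ) : Amb := (x, ∑ i, a i • asdFrame x i)

/-- The inclusion `SO(3) = SO(3) × {I₂} ⊂ SO(5)`. -/
def embedSO3 (g : Matrix (Fin 3) (Fin 3) ℝ) : Matrix (Fin 5) (Fin 5) ℝ :=
  !![g 0 0, g 0 1, g 0 2, 0, 0;
     g 1 0, g 1 1, g 1 2, 0, 0;
     g 2 0, g 2 1, g 2 2, 0, 0;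
     0, 0, 0, 1, 0;
     0, 0, 0, 0, 1]

/-- The lift of the action of `h ∈ SO(5)` on `S⁴` to `2`-forms: `(x, ω) ↦ (h x, (h⁻¹)^* ω)`. -/
def bundleAct (h : Matrix (Fin 5) (Fin 5) ℝ) (p : Amb) : Amb :=
  (h.mulVec p.1, fun i j => ∑ k, ∑ l, h i k * p.2 k l * h j l)

/-- The set `M_{C,D,E}`: the `SO(3)`-orbits of the points with coordinates
`((x₁, 0, 0, x₄, x₅), (a₁, a₂, 0))`, `x ∈ S⁴`, `r² = a₁² + a₂²`, such that
`x₄⁴ (λ + r²) = C`, `x₅⁴ (λ + r²) = D` and `a₁ x₁ = E`. -/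
def M (lam C D E : ℝ) : Set Amb :=
  {q | ∃ g ∈ Matrix.specialOrthogonalGroup (Fin 3) ℝ, ∃ x₁ x₄ x₅ a₁ a₂ : ℝ,
    x₁ ^ 2 + x₄ ^ 2 + x₅ ^ 2 = 1 ∧
    x₄ ^ 4 * (lam + (a₁ ^ 2 + a₂ ^ 2)) = C ∧
    x₅ ^ 4 * (lam + (a₁ ^ 2 + a₂ ^ 2)) = D ∧
    a₁ * x₁ = E ∧
    q = bundleAct (embedSO3 g) (bundlePoint ![x₁, 0, 0, x₄, x₅] ![a₁, a₂, 0])}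

/-- `s_λ = (λ + r²)^{1/4}`, where `r` is the fibre norm for which `ω₁, ω₂, ω₃` is orthonormal;
each `ω_i` has four matrix entries `± 1` in an orthonormal basis, whence the factor `1 / 4`. -/
def sFun (lam : ℝ) (p : Amb) : ℝ :=
  (lam + (1 / 4) * ∑ k, ∑ l, p.2 k l ^ 2) ^ (1 / 4 : ℝ)

/-- The horizontal forms `π^* e^i`, on a tangent vector `w = (ẋ, Ȧ)` of `Λ²₋S⁴` at `p`. -/
def horForm (p w : Amb) (i : Fin 4) : ℝ := ∑ k, frame p.1 i k * w.1 k

/-- The vertical forms `b_i = d a_i + ∑ j, a_j π^* γ_{ji}`. The connection of `Λ²₋S⁴` induced by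
the Levi-Civita connection of `S⁴ ⊂ ℝ⁵` is the orthogonal projection of the derivative to the
fibre, so `b_i (ẋ, Ȧ)` is the `ω_i`-component of `Ȧ`. -/
def vertForm (p w : Amb) (i : Fin 3) : ℝ := (1 / 4) * ∑ k, ∑ l, asdFrame p.1 i k l * w.2 k l

/-- The coframe `(b₁/s, b₂/s, b₃/s, √2 s e¹, √2 s e², √2 s e³, √2 s e⁴)`, `s = s_λ`, in which
`φ_λ = 2 s ∑ b_i ∧ π^* ω_i + s⁻³ b₁₂₃` is the standard `3`-form
`φ₀ = e¹²³ + e¹⁴⁵ - e¹⁶⁷ + e²⁴⁶ + e²⁵⁷ + e³⁴⁷ - e³⁵⁶` of `ℝ⁷`. -/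
def adaptedCoframe (lam : ℝ) (p w : Amb) : Fin 7 → ℝ :=
  ![vertForm p w 0 / sFun lam p, vertForm p w 1 / sFun lam p, vertForm p w 2 / sFun lam p,
    √2 * sFun lam p * horForm p w 0, √2 * sFun lam p * horForm p w 1,
    √2 * sFun lam p * horForm p w 2, √2 * sFun lam p * horForm p w 3]

/-- The `4`-form `e^{i j k l}` on `ℝ⁷` (indices from `0` to `6`). -/
def wedge4 (i j k l : Fin 7) (v : Fin 4 → Fin 7 → ℝ) : ℝ :=
  Matrix.det (Matrix.of fun m n : Fin 4 => v n (![i, j, k, l] m))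

/-- `*φ₀ = e⁴⁵⁶⁷ + e²³⁶⁷ - e²³⁴⁵ + e¹³⁵⁷ + e¹³⁴⁶ + e¹²⁵⁶ - e¹²⁴⁷` on `ℝ⁷`. -/
def starPhi0 (v : Fin 4 → Fin 7 → ℝ) : ℝ :=
  wedge4 3 4 5 6 v + wedge4 1 2 5 6 v - wedge4 1 2 3 4 v + wedge4 0 2 4 6 v
    + wedge4 0 2 3 5 v + wedge4 0 1 4 5 v - wedge4 0 1 3 6 v

/-- The calibration `*φ_λ` at `p`, on four tangent vectors of `Λ²₋S⁴`. -/
def starPhi (lam : ℝ) (p : Amb) (w : Fin 4 → Amb) : ℝ :=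
  starPhi0 fun n => adaptedCoframe lam p (w n)

/-- The coordinate tangent vectors of a parametrization at `u`. -/
def coordTangent (F : (Fin 4 → ℝ) → Amb) (u : Fin 4 → ℝ) : Fin 4 → Amb :=
  fun i => fderiv ℝ F u (Pi.single i 1)

/-- A smooth parametrized piece of a `4`-dimensional `S ⊂ Λ²₋S⁴`, positively oriented for the
calibration `*φ_λ` that orients coassociative submanifolds. Since `*φ_λ` is alternating, the
last field makes the map an immersion. -/
structure OrientedPatch (lam : ℝ) (S : Set Amb) where
  toFun : (Fin 4 → ℝ) → Amb
  dom : Set (Fin 4 → ℝ)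
  isOpen_dom : IsOpen dom
  contDiffOn : ContDiffOn ℝ ∞ toFun dom
  injOn : Set.InjOn toFun dom
  mapsTo : Set.MapsTo toFun dom S
  pos : ∀ u ∈ dom, 0 < starPhi lam (toFun u) (coordTangent toFun u)

/-- Compactly supported smooth `4`-forms. As `Λ²₋S⁴` is closed in `Amb`, their restrictions are
all compactly supported smooth `4`-forms on `Λ²₋S⁴`. -/
structure TestForm where
  form : Amb → Amb [⋀^Fin 4]→L[ℝ] ℝ
  contDiff : ContDiff ℝ ∞ form
  hasCompactSupport : HasCompactSupport form

/-- The coefficient of the pullback `F^* α` with respect to `du₁ ∧ du₂ ∧ du₃ ∧ du₄`. -/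
def pullbackCoeff (F : (Fin 4 → ℝ) → Amb) (α : TestForm) (u : Fin 4 → ℝ) : ℝ :=
  α.form (F u) (coordTangent F u)

/-- `T` is the current of integration `α ↦ ∫_S α` over `S` oriented by `*φ_λ`: the set `S` is,
up to a set of zero `4`-dimensional Hausdorff measure, the disjoint union of countably many
measurable parts of positively oriented smooth patches, and `T α` is the absolutely convergent sum
of the integrals of `α` over these parts. By the change of variables formula the value
does not depend on the decomposition. -/
def IsIntegrationCurrent (lam : ℝ) (S : Set Amb) (T : TestForm → ℝ) : Prop :=
  ∃ (P : ℕ → OrientedPatch lam S) (B : ℕ → Set (Fin 4 → ℝ)),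
    (∀ i, MeasurableSet (B i) ∧ B i ⊆ (P i).dom) ∧
    Pairwise (fun i j => Disjoint ((P i).toFun '' B i) ((P j).toFun '' B j)) ∧
    Measure.hausdorffMeasure 4 (S \ ⋃ i, (P i).toFun '' B i) = 0 ∧
    ∀ α : TestForm,
      (∀ i, IntegrableOn (pullbackCoeff (P i).toFun α) (B i)) ∧
      Summable (fun i => ∫ u in B i, |pullbackCoeff (P i).toFun α u|) ∧
      HasSum (fun i => ∫ u in B i, pullbackCoeff (P i).toFun α u) (T α)

/-- The sets `S j` and `S'` carry currents of integration, and `∫_{S j} α → ∫_{S'} α` for every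
compactly supported smooth `4`-form `α`. -/
def ConvergesAsCurrents (lam : ℝ) (S : ℕ → Set Amb) (S' : Set Amb) : Prop :=
  ∃ (T : ℕ → TestForm → ℝ) (T' : TestForm → ℝ),
    (∀ j, IsIntegrationCurrent lam (S j) (T j)) ∧ IsIntegrationCurrent lam S' T' ∧
    ∀ α : TestForm, Tendsto (fun j => T j α) atTop (𝓝 (T' α))

end

end CoassocSO3

/-! When E = 0, every point of the slice has a₁ = 0 or x₁ = 0. Where x₁ = 0 or r = 0, the
`SO(3)`-orbits sweep out a set of dimension at most 3, which is null for the 4-dimensional Hausdorff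
measure. Elsewhere a₁ = 0, and elements of `SO(3)` change the signs of a₂ and of x₁, so both may be
taken positive. With z = √(λ + r²) and a sign choice ε⁴ = C, η⁴ = D, the remaining coordinates are
x₄ = ε z^{-1/2}, x₅ = η z^{-1/2}, a₂² = z² - λ, x₁² = 1 - (ε² + η²)/z. Hence z runs over all values
above both √λ and ε² + η² = √C + √D, and each pair (ε, η) gives one sheet: a half line times
`SO(3)`, which acts freely on it.

The critical value √C + √D = √λ is where the two lower bounds for z change places. Putting z =
max(√λ, ε² + η²) + t² gives every sheet the same domain t > 0. The maximum is continuous in (ε, η),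
also at the critical value, and the square t² cancels the square-root singularities of a₂ and x₁ at
the endpoint, so that their velocities stay bounded. The pulled-back coefficient of a test form then
converges pointwise and is dominated by a constant on a bounded box (the form has compact support
and r grows with t). Dominated convergence finishes the argument, sheet by sheet.

Two points need care. The fibre frame is singular at x₅ = 1, which shows up only through κ = x₄ / (1
- x₅); this is bounded as long as ε is identically 0 or stays away from 0, and one of these holds in
each case of the theorem. The orientation is fixed by `starPhi_slice`: the calibration pulls back to
the derivative of (x₁ a)² times the sine of the middle Euler angle, which is positive.

The main lemmas are `starPhi_act` and `starPhi_slice` (orientation), `sheet_injective` and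
`exists_sheet_of_mem_M` (decomposition into sheets), `exists_bound_curve` (domination) and
`tendsto_sheetIntegral` (limit). -/

namespace CoassocSO3

noncomputable section

open Matrix

/-! ### Rotation matrices and the action on the bundle -/

/-- Every rotation matrix is equal to its cofactor matrix. -/
lemma adjugate_of_mem_SO3 {g : Matrix (Fin 3) (Fin 3) ℝ}
    (hg : g ∈ specialOrthogonalGroup (Fin 3) ℝ) : g.adjugate = gᵀ := by
  obtain ⟨h1, h2⟩ := mem_specialOrthogonalGroup_iff.1 hg
  have h3 := (mem_orthogonalGroup_iff' _ _).1 h1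
  calc g.adjugate = (gᵀ * g) * g.adjugate := by rw [h3, one_mul]
    _ = gᵀ := by rw [Matrix.mul_assoc, mul_adjugate, h2, one_smul, mul_one]

/-- These identities turn 2 × 2 minors of a rotation into single entries; every equivariance
computation below rests on them. -/
lemma cofactor_of_mem_SO3 {g : Matrix (Fin 3) (Fin 3) ℝ}
    (hg : g ∈ specialOrthogonalGroup (Fin 3) ℝ) :
    (g 0 0 = g 1 1 * g 2 2 - g 1 2 * g 2 1 ∧ g 0 1 = g 1 2 * g 2 0 - g 1 0 * g 2 2 ∧
      g 0 2 = g 1 0 * g 2 1 - g 1 1 * g 2 0) ∧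
    (g 1 0 = g 2 1 * g 0 2 - g 2 2 * g 0 1 ∧ g 1 1 = g 2 2 * g 0 0 - g 2 0 * g 0 2 ∧
      g 1 2 = g 2 0 * g 0 1 - g 2 1 * g 0 0) ∧
    (g 2 0 = g 0 1 * g 1 2 - g 0 2 * g 1 1 ∧ g 2 1 = g 0 2 * g 1 0 - g 0 0 * g 1 2 ∧
      g 2 2 = g 0 0 * g 1 1 - g 0 1 * g 1 0) := by
  have h := adjugate_of_mem_SO3 hg
  rw [adjugate_fin_three] at h
  have h00 := congrFun (congrFun h 0) 0
  have h01 := congrFun (congrFun h 0) 1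
  have h02 := congrFun (congrFun h 0) 2
  have h10 := congrFun (congrFun h 1) 0
  have h11 := congrFun (congrFun h 1) 1
  have h12 := congrFun (congrFun h 1) 2
  have h20 := congrFun (congrFun h 2) 0
  have h21 := congrFun (congrFun h 2) 1
  have h22 := congrFun (congrFun h 2) 2
  simp at h00 h01 h02 h10 h11 h12 h20 h21 h22
  refine ⟨⟨?_, ?_, ?_⟩, ⟨?_, ?_, ?_⟩, ⟨?_, ?_, ?_⟩⟩ <;> linarith

lemma rows_of_mem_SO3 {g : Matrix (Fin 3) (Fin 3) ℝ}
    (hg : g ∈ specialOrthogonalGroup (Fin 3) ℝ) (i j : Fin 3) :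
    g i 0 * g j 0 + g i 1 * g j 1 + g i 2 * g j 2 = if i = j then 1 else 0 := by
  have h := congrFun (congrFun ((mem_orthogonalGroup_iff _ _).1
    (mem_specialOrthogonalGroup_iff.1 hg).1) i) j
  rwa [mul_apply, Fin.sum_univ_three, one_apply] at h

lemma columns_of_mem_SO3 {g : Matrix (Fin 3) (Fin 3) ℝ}
    (hg : g ∈ specialOrthogonalGroup (Fin 3) ℝ) (i j : Fin 3) :
    g 0 i * g 0 j + g 1 i * g 1 j + g 2 i * g 2 j = if i = j then 1 else 0 := by
  have h := congrFun (congrFun ((mem_orthogonalGroup_iff' _ _).1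
    (mem_specialOrthogonalGroup_iff.1 hg).1) i) j
  rwa [mul_apply, Fin.sum_univ_three, one_apply] at h

lemma mulVec_cross_of_mem_SO3 {g : Matrix (Fin 3) (Fin 3) ℝ}
    (hg : g ∈ specialOrthogonalGroup (Fin 3) ℝ) (a b : Fin 3 → ℝ) :
    (g *ᵥ a) ⨯₃ (g *ᵥ b) = g *ᵥ (a ⨯₃ b) := by
  obtain ⟨⟨h00, h01, h02⟩, ⟨h10, h11, h12⟩, h20, h21, h22⟩ := cofactor_of_mem_SO3 hg
  ext i
  fin_cases i <;> simp [cross_apply, mulVec, dotProduct, Fin.sum_univ_three]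
  · rw [h00, h01, h02]; ring
  · rw [h10, h11, h12]; ring
  · rw [h20, h21, h22]; ring

lemma mulVec_dotProduct_of_mem_SO3 {g : Matrix (Fin 3) (Fin 3) ℝ}
    (hg : g ∈ specialOrthogonalGroup (Fin 3) ℝ) (a b : Fin 3 → ℝ) :
    (g *ᵥ a) ⬝ᵥ (g *ᵥ b) = a ⬝ᵥ b := by
  rw [dotProduct_mulVec, vecMul_mulVec,
    (mem_orthogonalGroup_iff' _ _).1 (mem_specialOrthogonalGroup_iff.1 hg).1, vecMul_one]

lemma embedSO3_mul (g h : Matrix (Fin 3) (Fin 3) ℝ) :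
    embedSO3 (g * h) = embedSO3 g * embedSO3 h := by
  ext i j
  fin_cases i <;> fin_cases j <;>
    simp [embedSO3, mul_apply, Fin.sum_univ_three, Fin.sum_univ_five]

lemma embedSO3_one : embedSO3 1 = 1 := by
  ext i j
  fin_cases i <;> fin_cases j <;> simp [embedSO3, one_apply]

lemma embedSO3_transpose (g : Matrix (Fin 3) (Fin 3) ℝ) : embedSO3 gᵀ = (embedSO3 g)ᵀ := by
  ext i j
  fin_cases i <;> fin_cases j <;> simp [embedSO3]

lemma embedSO3_transpose_mul_self {g : Matrix (Fin 3) (Fin 3) ℝ}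
    (hg : g ∈ specialOrthogonalGroup (Fin 3) ℝ) : (embedSO3 g)ᵀ * embedSO3 g = 1 := by
  rw [← embedSO3_transpose, ← embedSO3_mul,
    (mem_orthogonalGroup_iff' _ _).1 (mem_specialOrthogonalGroup_iff.1 hg).1, embedSO3_one]

lemma bundleAct_eq (h : Matrix (Fin 5) (Fin 5) ℝ) (p : Amb) :
    bundleAct h p = (h *ᵥ p.1, h * of p.2 * hᵀ) := by
  refine Prod.ext rfl ?_
  ext i j
  simp only [bundleAct, mul_apply, Finset.sum_mul, transpose_apply, of_apply]
  exact Finset.sum_comm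

lemma bundleAct_mul (h k : Matrix (Fin 5) (Fin 5) ℝ) (p : Amb) :
    bundleAct (h * k) p = bundleAct h (bundleAct k p) := by
  rw [bundleAct_eq, bundleAct_eq, bundleAct_eq]
  refine Prod.ext (mulVec_mulVec p.1 h k).symm ?_
  change h * k * of p.2 * (h * k)ᵀ = h * (k * of p.2 * kᵀ) * hᵀ
  simp only [transpose_mul, Matrix.mul_assoc]

/-! ### Equivariance of the frame and of the horizontal and vertical forms -/

/-- The rotation of the frame `e₁, …, e₄` under the action of `g`. -/
def frameRot (g : Matrix (Fin 3) (Fin 3) ℝ) : Matrix (Fin 4) (Fin 4) ℝ :=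
  !![g 2 2, -g 2 1, g 2 0, 0; -g 1 2, g 1 1, -g 1 0, 0; g 0 2, -g 0 1, g 0 0, 0; 0, 0, 0, 1]

/-- The vector e₄ points along the gradient of x₅, which rotations preserve, while the triple (e₃,
-e₂, e₁) transforms like a vector of ℝ³. The normalizing factor depends on x₅ alone, so it plays no
role. -/
lemma frame_embedSO3 {g : Matrix (Fin 3) (Fin 3) ℝ}
    (hg : g ∈ specialOrthogonalGroup (Fin 3) ℝ) (x : Fin 5 → ℝ) (hx : x 4 ^ 2 ≠ 1) :
    of (frame (embedSO3 g *ᵥ x)) = frameRot g * of (frame x) * (embedSO3 g)ᵀ := by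
  obtain ⟨⟨h00, h01, h02⟩, ⟨h10, h11, h12⟩, h20, h21, h22⟩ := cofactor_of_mem_SO3 hg
  have r00 := rows_of_mem_SO3 hg 0 0
  have r01 := rows_of_mem_SO3 hg 0 1
  have r02 := rows_of_mem_SO3 hg 0 2
  have r11 := rows_of_mem_SO3 hg 1 1
  have r12 := rows_of_mem_SO3 hg 1 2
  have r22 := rows_of_mem_SO3 hg 2 2
  simp at r00 r01 r02 r11 r12 r22
  have e4 : (embedSO3 g *ᵥ x) 4 = x 4 := by
    simp [embedSO3, mulVec, dotProduct, Fin.sum_univ_five]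
  rw [frame, frame, e4, if_neg hx, if_neg hx]
  generalize (√(1 - x 4 ^ 2))⁻¹ = n
  ext i j
  fin_cases i <;> fin_cases j <;>
    simp [embedSO3, frameRot, mul_apply, mulVec, dotProduct, Fin.sum_univ_five] <;> grind

lemma horForm_eq (p w : Amb) (i : Fin 4) : horForm p w i = (of (frame p.1) *ᵥ w.1) i := rfl

/-- In terms of the matrix F Ȧ Fᵀ of the 2-form in the frame F, a change of frame is a conjugation.
-/
lemma vertForm_eq (p w : Amb) :
    vertForm p w 0 = (1 / 4) *
      ((of (frame p.1) * of w.2 * (of (frame p.1))ᵀ) 0 1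
      - (of (frame p.1) * of w.2 * (of (frame p.1))ᵀ) 1 0
      - (of (frame p.1) * of w.2 * (of (frame p.1))ᵀ) 2 3
      + (of (frame p.1) * of w.2 * (of (frame p.1))ᵀ) 3 2) ∧
    vertForm p w 1 = (1 / 4) *
      ((of (frame p.1) * of w.2 * (of (frame p.1))ᵀ) 0 2
      - (of (frame p.1) * of w.2 * (of (frame p.1))ᵀ) 2 0
      - (of (frame p.1) * of w.2 * (of (frame p.1))ᵀ) 3 1
      + (of (frame p.1) * of w.2 * (of (frame p.1))ᵀ) 1 3) ∧
    vertForm p w 2 = (1 / 4) *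
      ((of (frame p.1) * of w.2 * (of (frame p.1))ᵀ) 0 3
      - (of (frame p.1) * of w.2 * (of (frame p.1))ᵀ) 3 0
      - (of (frame p.1) * of w.2 * (of (frame p.1))ᵀ) 1 2
      + (of (frame p.1) * of w.2 * (of (frame p.1))ᵀ) 2 1) := by
  have key : ∀ i j, (of (frame p.1) * of w.2 * (of (frame p.1))ᵀ) i j =
      ∑ k, ∑ l, frame p.1 i k * frame p.1 j l * w.2 k l := by
    intro i j
    simp only [mul_apply, Finset.sum_mul, transpose_apply, of_apply]
    rw [Finset.sum_comm]
    exact Finset.sum_congr rfl fun _ _ => Finset.sum_congr rfl fun _ _ => by ring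
  have swap : ∀ i j, ∑ k, ∑ l, frame p.1 i k * frame p.1 j l * w.2 k l =
      ∑ k, ∑ l, frame p.1 j l * frame p.1 i k * w.2 k l := fun i j =>
    Finset.sum_congr rfl fun _ _ => Finset.sum_congr rfl fun _ _ => by ring
  refine ⟨?_, ?_, ?_⟩ <;>
  · simp only [key, vertForm, asdFrame, ← Finset.sum_sub_distrib, ← Finset.sum_add_distrib]
    congr 1
    refine Finset.sum_congr rfl fun k _ => Finset.sum_congr rfl fun l _ => ?_
    simp [wedgeMat]
    ring

lemma horForm_act {g : Matrix (Fin 3) (Fin 3) ℝ}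
    (hg : g ∈ specialOrthogonalGroup (Fin 3) ℝ) (p w : Amb) (hp : p.1 4 ^ 2 ≠ 1) :
    (horForm (bundleAct (embedSO3 g) p) (bundleAct (embedSO3 g) w)) =
      frameRot g *ᵥ horForm p w := by
  ext i
  rw [horForm_eq, bundleAct_eq, bundleAct_eq, frame_embedSO3 hg p.1 hp]
  change ((frameRot g * of (frame p.1) * (embedSO3 g)ᵀ) *ᵥ (embedSO3 g *ᵥ w.1)) i =
    (frameRot g *ᵥ (of (frame p.1) *ᵥ w.1)) i
  rw [mulVec_mulVec, mulVec_mulVec, Matrix.mul_assoc _ _ (embedSO3 g),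
    embedSO3_transpose_mul_self hg, Matrix.mul_one]

/-- Conjugating by the frame rotation produces 2 × 2 minors of g, which the cofactor identities
reduce to entries of g. The sign on the third component comes from the orientation of the triple
(e₃, -e₂, e₁). -/
lemma vertForm_act {g : Matrix (Fin 3) (Fin 3) ℝ}
    (hg : g ∈ specialOrthogonalGroup (Fin 3) ℝ) (p w : Amb) (hp : p.1 4 ^ 2 ≠ 1) :
    ![vertForm (bundleAct (embedSO3 g) p) (bundleAct (embedSO3 g) w) 0,
      vertForm (bundleAct (embedSO3 g) p) (bundleAct (embedSO3 g) w) 1,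
      -vertForm (bundleAct (embedSO3 g) p) (bundleAct (embedSO3 g) w) 2] =
    g *ᵥ ![vertForm p w 0, vertForm p w 1, -vertForm p w 2] := by
  have hN : of (frame (bundleAct (embedSO3 g) p).1) * of (bundleAct (embedSO3 g) w).2 *
      (of (frame (bundleAct (embedSO3 g) p).1))ᵀ =
      frameRot g * (of (frame p.1) * of w.2 * (of (frame p.1))ᵀ) * (frameRot g)ᵀ := by
    rw [bundleAct_eq, bundleAct_eq, frame_embedSO3 hg p.1 hp]
    change (frameRot g * of (frame p.1) * (embedSO3 g)ᵀ) *
      (embedSO3 g * of w.2 * (embedSO3 g)ᵀ) *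
      (frameRot g * of (frame p.1) * (embedSO3 g)ᵀ)ᵀ = _
    simp only [transpose_mul, transpose_transpose, Matrix.mul_assoc]
    simp only [← Matrix.mul_assoc (embedSO3 g)ᵀ (embedSO3 g), embedSO3_transpose_mul_self hg,
      Matrix.one_mul]
  obtain ⟨a0, a1, a2⟩ := vertForm_eq p w
  obtain ⟨b0, b1, b2⟩ := vertForm_eq (bundleAct (embedSO3 g) p) (bundleAct (embedSO3 g) w)
  rw [a0, a1, a2, b0, b1, b2, hN]
  generalize of (frame p.1) * of w.2 * (of (frame p.1))ᵀ = N
  obtain ⟨⟨h00, h01, h02⟩, ⟨h10, h11, h12⟩, h20, h21, h22⟩ := cofactor_of_mem_SO3 hg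
  ext i
  fin_cases i <;>
    simp [frameRot, mul_apply, mulVec, vecMul, dotProduct, Fin.sum_univ_three,
      Fin.sum_univ_four]
  · linear_combination (-(1 / 4) * (N 0 1 - N 1 0)) * h00 + (-(1 / 4) * (N 0 2 - N 2 0)) * h01
      + (-(1 / 4)) * (N 1 2 - N 2 1) * h02
  · linear_combination (-(1 / 4) * (N 0 1 - N 1 0)) * h10 + (-(1 / 4) * (N 0 2 - N 2 0)) * h11
      + (-(1 / 4)) * (N 1 2 - N 2 1) * h12
  · linear_combination (-(1 / 4) * (N 0 1 - N 1 0)) * h20 + (-(1 / 4) * (N 0 2 - N 2 0)) * h21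
      + (-(1 / 4)) * (N 1 2 - N 2 1) * h22

/-! ### The calibration in terms of cross products, and its invariance -/

/-- Laplace expansion along complementary pairs of rows; products of 2 × 2 minors are the terms that
cross products produce. -/
lemma wedge4_expand (i j k l : Fin 7) (v : Fin 4 → Fin 7 → ℝ) :
    wedge4 i j k l v =
      (v 0 i * v 1 j - v 1 i * v 0 j) * (v 2 k * v 3 l - v 3 k * v 2 l)
      - (v 0 i * v 2 j - v 2 i * v 0 j) * (v 1 k * v 3 l - v 3 k * v 1 l)
      + (v 0 i * v 3 j - v 3 i * v 0 j) * (v 1 k * v 2 l - v 2 k * v 1 l)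
      + (v 1 i * v 2 j - v 2 i * v 1 j) * (v 0 k * v 3 l - v 3 k * v 0 l)
      - (v 1 i * v 3 j - v 3 i * v 1 j) * (v 0 k * v 2 l - v 2 k * v 0 l)
      + (v 2 i * v 3 j - v 3 i * v 2 j) * (v 0 k * v 1 l - v 1 k * v 0 l) := by
  rw [wedge4, det_succ_row_zero]
  simp [Fin.sum_univ_four, det_fin_three, submatrix, Fin.succAbove]
  ring

/-- The components of a vector of `ℝ⁷` on which `SO(3)` acts by rotations. -/
def vertPart (v : Fin 7 → ℝ) : Fin 3 → ℝ := ![v 0, v 1, -v 2]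

/-- The components of a vector of `ℝ⁷` on which `SO(3)` acts by rotations. -/
def horPart (v : Fin 7 → ℝ) : Fin 3 → ℝ := ![v 5, -v 4, v 3]

/-- The self-dual pairing that is contracted with the vertical part in `*φ₀`. -/
def horPair (v w : Fin 7 → ℝ) : Fin 3 → ℝ :=
  horPart v ⨯₃ horPart w + (v 6 • horPart w - w 6 • horPart v)

/-- Only dot and cross products of the two ℝ³-valued parts occur, besides the invariant last
component, so rotation invariance becomes visible. -/
lemma starPhi0_eq (v : Fin 4 → Fin 7 → ℝ) :
    starPhi0 v =
      v 3 6 * (horPart (v 0) ⬝ᵥ (horPart (v 1) ⨯₃ horPart (v 2)))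
      - v 2 6 * (horPart (v 0) ⬝ᵥ (horPart (v 1) ⨯₃ horPart (v 3)))
      + v 1 6 * (horPart (v 0) ⬝ᵥ (horPart (v 2) ⨯₃ horPart (v 3)))
      - v 0 6 * (horPart (v 1) ⬝ᵥ (horPart (v 2) ⨯₃ horPart (v 3)))
      + (vertPart (v 0) ⨯₃ vertPart (v 1)) ⬝ᵥ horPair (v 2) (v 3)
      - (vertPart (v 0) ⨯₃ vertPart (v 2)) ⬝ᵥ horPair (v 1) (v 3)
      + (vertPart (v 0) ⨯₃ vertPart (v 3)) ⬝ᵥ horPair (v 1) (v 2)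
      + (vertPart (v 1) ⨯₃ vertPart (v 2)) ⬝ᵥ horPair (v 0) (v 3)
      - (vertPart (v 1) ⨯₃ vertPart (v 3)) ⬝ᵥ horPair (v 0) (v 2)
      + (vertPart (v 2) ⨯₃ vertPart (v 3)) ⬝ᵥ horPair (v 0) (v 1) := by
  simp only [starPhi0, wedge4_expand, vertPart, horPart, horPair, cross_apply, dotProduct,
    Fin.sum_univ_three, Pi.add_apply, Pi.sub_apply, Pi.smul_apply, smul_eq_mul, cons_val]
  ring

lemma starPhi0_rotate {g : Matrix (Fin 3) (Fin 3) ℝ}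
    (hg : g ∈ specialOrthogonalGroup (Fin 3) ℝ) (v w : Fin 4 → Fin 7 → ℝ)
    (hB : ∀ n, vertPart (w n) = g *ᵥ vertPart (v n))
    (hH : ∀ n, horPart (w n) = g *ᵥ horPart (v n)) (hz : ∀ n, w n 6 = v n 6) :
    starPhi0 w = starPhi0 v := by
  have hP : ∀ m n, horPair (w m) (w n) = g *ᵥ horPair (v m) (v n) := fun m n => by
    simp only [horPair, hH, hz, mulVec_cross_of_mem_SO3 hg, mulVec_add, mulVec_sub, mulVec_smul]
  simp only [starPhi0_eq, hP, hB, hH, hz, mulVec_cross_of_mem_SO3 hg,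
    mulVec_dotProduct_of_mem_SO3 hg]

/-- The sum of squares is the trace of A Aᵀ, which orthogonal conjugation preserves. -/
lemma sum_sq_act {g : Matrix (Fin 3) (Fin 3) ℝ}
    (hg : g ∈ specialOrthogonalGroup (Fin 3) ℝ) (p : Amb) :
    ∑ k, ∑ l, (bundleAct (embedSO3 g) p).2 k l ^ 2 = ∑ k, ∑ l, p.2 k l ^ 2 := by
  have key : ∀ A : Matrix (Fin 5) (Fin 5) ℝ, ∑ k, ∑ l, A k l ^ 2 = (A * Aᵀ).trace := fun A => by
    simp [trace, mul_apply, sq]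
  have h := embedSO3_transpose_mul_self hg
  rw [bundleAct_eq]
  refine (key _).trans (Eq.trans ?_ (key (of p.2)).symm)
  simp only [transpose_mul, transpose_transpose, Matrix.mul_assoc]
  simp only [← Matrix.mul_assoc (embedSO3 g)ᵀ (embedSO3 g), h, Matrix.one_mul]
  rw [trace_mul_comm]
  simp only [Matrix.mul_assoc, h, Matrix.mul_one]

lemma sFun_act (lam : ℝ) {g : Matrix (Fin 3) (Fin 3) ℝ}
    (hg : g ∈ specialOrthogonalGroup (Fin 3) ℝ) (p : Amb) :
    sFun lam (bundleAct (embedSO3 g) p) = sFun lam p := by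
  rw [sFun, sFun, sum_sq_act hg]

/-- The calibration `*φ_λ` is invariant under `SO(3)`. -/
lemma starPhi_act (lam : ℝ) {g : Matrix (Fin 3) (Fin 3) ℝ}
    (hg : g ∈ specialOrthogonalGroup (Fin 3) ℝ) (p : Amb) (w : Fin 4 → Amb)
    (hp : p.1 4 ^ 2 ≠ 1) :
    starPhi lam (bundleAct (embedSO3 g) p) (fun n => bundleAct (embedSO3 g) (w n)) =
      starPhi lam p w := by
  refine starPhi0_rotate hg _ _ (fun n => ?_) (fun n => ?_) (fun n => ?_)
  · have h := congrArg (fun b : Fin 3 → ℝ => (sFun lam p)⁻¹ • b) (vertForm_act hg p (w n) hp)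
    simp only [← mulVec_smul] at h
    convert h using 2
    · ext i
      fin_cases i <;> simp [vertPart, adaptedCoframe, sFun_act lam hg, div_eq_inv_mul]
    · ext i
      fin_cases i <;> simp [vertPart, adaptedCoframe, div_eq_inv_mul]
  · have h := horForm_act hg p (w n) hp
    have h0 := congrFun h 0
    have h1 := congrFun h 1
    have h2 := congrFun h 2
    ext i
    fin_cases i <;>
      simp [horPart, adaptedCoframe, sFun_act lam hg, h0, h1, h2, frameRot, mulVec,
        dotProduct, Fin.sum_univ_three, Fin.sum_univ_four] <;> ring
  · have h3 := congrFun (horForm_act hg p (w n) hp) 3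
    simp [adaptedCoframe, sFun_act lam hg, h3, frameRot, mulVec,
      dotProduct, Fin.sum_univ_four]

/-! ### Slice points and the calibration on their orbits -/

/-- The point over `(x₁, 0, 0, x₄, x₅)` with fibre coordinates `(0, a, 0)`, written polynomially in
`c = (a, x₁, x₄, x₅, κ)` with `κ = x₄ / (1 - x₅)`. -/
def slicePoint (c : Fin 5 → ℝ) : Amb :=
  (![c 1, 0, 0, c 2, c 3],
    ![![0, c 0 * (c 1 * c 4), c 0 * (c 3 - c 2 * c 4), 0, 0],
      ![-(c 0 * (c 1 * c 4)), 0, 0, c 0 * (1 - c 2 * c 4), c 0 * c 2],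
      ![-(c 0 * (c 3 - c 2 * c 4)), 0, 0, -(c 0 * (c 1 * c 4)), c 0 * c 1],
      ![0, -(c 0 * (1 - c 2 * c 4)), c 0 * (c 1 * c 4), 0, 0],
      ![0, -(c 0 * c 2), -(c 0 * c 1), 0, 0]])

/-- The derivative of `slicePoint` at `c` in the direction `d`. -/
def sliceVelocity (c d : Fin 5 → ℝ) : Amb :=
  (![d 1, 0, 0, d 2, d 3],
    ![![0, d 0 * (c 1 * c 4) + c 0 * (d 1 * c 4 + c 1 * d 4),
        d 0 * (c 3 - c 2 * c 4) + c 0 * (d 3 - (d 2 * c 4 + c 2 * d 4)), 0, 0],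
      ![-(d 0 * (c 1 * c 4) + c 0 * (d 1 * c 4 + c 1 * d 4)), 0, 0,
        d 0 * (1 - c 2 * c 4) - c 0 * (d 2 * c 4 + c 2 * d 4), d 0 * c 2 + c 0 * d 2],
      ![-(d 0 * (c 3 - c 2 * c 4) + c 0 * (d 3 - (d 2 * c 4 + c 2 * d 4))), 0, 0,
        -(d 0 * (c 1 * c 4) + c 0 * (d 1 * c 4 + c 1 * d 4)), d 0 * c 1 + c 0 * d 1],
      ![0, -(d 0 * (1 - c 2 * c 4) - c 0 * (d 2 * c 4 + c 2 * d 4)),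
        d 0 * (c 1 * c 4) + c 0 * (d 1 * c 4 + c 1 * d 4), 0, 0],
      ![0, -(d 0 * c 2 + c 0 * d 2), -(d 0 * c 1 + c 0 * d 1), 0, 0]])

/-- The infinitesimal rotation `v ↦ ξ × v` of the first three coordinates. -/
def infRot (ξ : Fin 3 → ℝ) : Matrix (Fin 5) (Fin 5) ℝ :=
  !![0, -ξ 2, ξ 1, 0, 0; ξ 2, 0, -ξ 0, 0, 0; -ξ 1, ξ 0, 0, 0, 0; 0, 0, 0, 0, 0; 0, 0, 0, 0, 0]

/-- The infinitesimal action of a matrix on the bundle. -/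
def infAct (L : Matrix (Fin 5) (Fin 5) ℝ) (p : Amb) : Amb :=
  (L *ᵥ p.1, L * of p.2 + of p.2 * Lᵀ)

/-- The constraints between the coordinates of a slice point. -/
structure IsSlice (c : Fin 5 → ℝ) : Prop where
  sphere : c 1 ^ 2 + c 2 ^ 2 + c 3 ^ 2 = 1
  proj : c 4 * (1 - c 3) = c 2
  nonpole : c 3 ^ 2 ≠ 1

lemma IsSlice.pos {c : Fin 5 → ℝ} (hc : IsSlice c) : 0 < 1 - c 3 ^ 2 := by
  have h1 := hc.sphere
  have h2 := hc.nonpole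
  refine lt_of_le_of_ne ?_ fun h => h2 (by linarith)
  nlinarith [sq_nonneg (c 1), sq_nonneg (c 2)]

lemma IsSlice.norm {c : Fin 5 → ℝ} (hc : IsSlice c) :
    (√(1 - c 3 ^ 2))⁻¹ ^ 2 * (1 - c 3 ^ 2) = 1 := by
  rw [inv_pow, Real.sq_sqrt hc.pos.le, inv_mul_cancel₀ hc.pos.ne']

-- The normalizing factor enters squared, as 1 / (1 - x₅²). The factor 1 + x₅ cancels, and κ absorbs
-- the remaining 1 - x₅.
set_option maxHeartbeats 4000000 in
lemma asdFrame_slice {c : Fin 5 → ℝ} (hc : IsSlice c) :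
    asdFrame ![c 1, 0, 0, c 2, c 3] =
      ![![![0, 0, 0, -c 3, c 2], ![0, 0, 1, 0, 0], ![0, -1, 0, 0, 0], ![c 3, 0, 0, 0, -c 1],
          ![-c 2, 0, 0, c 1, 0]],
        ![![0, c 1 * c 4, c 3 - c 2 * c 4, 0, 0],
          ![-(c 1 * c 4), 0, 0, 1 - c 2 * c 4, c 2],
          ![-(c 3 - c 2 * c 4), 0, 0, -(c 1 * c 4), c 1],
          ![0, -(1 - c 2 * c 4), c 1 * c 4, 0, 0], ![0, -c 2, -c 1, 0, 0]],
        ![![0, c 3 - c 2 * c 4, -(c 1 * c 4), 0, 0],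
          ![-(c 3 - c 2 * c 4), 0, 0, -(c 1 * c 4), c 1],
          ![c 1 * c 4, 0, 0, -(1 - c 2 * c 4), -c 2],
          ![0, c 1 * c 4, 1 - c 2 * c 4, 0, 0], ![0, -c 1, c 2, 0, 0]]] := by
  have hn := hc.norm
  have hp := hc.pos.ne'
  have h1 := hc.sphere
  have h2 := hc.proj
  have h4 : 1 - c 3 ≠ 0 := fun h => hp (by linear_combination (1 + c 3) * h)
  have hf : frame ![c 1, 0, 0, c 2, c 3] = (√(1 - c 3 ^ 2))⁻¹ •
      ![![0, c 1, -c 2, 0, 0], ![0, c 2, c 1, 0, 0], ![-c 2, 0, 0, c 1, 0],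
        ![-c 1 * c 3, 0, 0, -c 2 * c 3, 1 - c 3 ^ 2]] := by
    have h3 : (![c 1, 0, 0, c 2, c 3] : Fin 5 → ℝ) 4 = c 3 := rfl
    rw [frame, h3, if_neg hc.nonpole]
    simp
  rw [asdFrame, hf]
  generalize (√(1 - c 3 ^ 2))⁻¹ = n at hn
  ext i k l
  fin_cases i <;> fin_cases k <;> fin_cases l <;> simp [wedgeMat] <;> grind

lemma bundlePoint_slice {c : Fin 5 → ℝ} (hc : IsSlice c) :
    bundlePoint ![c 1, 0, 0, c 2, c 3] ![0, c 0, 0] = slicePoint c := by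
  rw [bundlePoint, asdFrame_slice hc, Fin.sum_univ_three]
  refine Prod.ext rfl ?_
  ext k l
  fin_cases k <;> fin_cases l <;> simp [slicePoint] <;> ring

lemma frame_slice {c : Fin 5 → ℝ} (hc : IsSlice c) :
    frame ![c 1, 0, 0, c 2, c 3] = (√(1 - c 3 ^ 2))⁻¹ •
      ![![0, c 1, -c 2, 0, 0], ![0, c 2, c 1, 0, 0], ![-c 2, 0, 0, c 1, 0],
        ![-c 1 * c 3, 0, 0, -c 2 * c 3, 1 - c 3 ^ 2]] := by
  have h3 : (![c 1, 0, 0, c 2, c 3] : Fin 5 → ℝ) 4 = c 3 := rfl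
  rw [frame, h3, if_neg hc.nonpole]
  simp

/-- Rotations move the base point along e₁ and e₂ only, whereas slice curves move it along e₃ and e₄
only; most terms of the calibration therefore vanish. -/
lemma horForm_infRot {c : Fin 5 → ℝ} (hc : IsSlice c) (ξ : Fin 3 → ℝ) :
    horForm (slicePoint c) (infAct (infRot ξ) (slicePoint c)) =
      (√(1 - c 3 ^ 2))⁻¹ • ![c 1 * (c 1 * ξ 2 + c 2 * ξ 1), c 1 * (c 2 * ξ 2 - c 1 * ξ 1), 0, 0] := by
  ext i
  have h : (slicePoint c).1 = ![c 1, 0, 0, c 2, c 3] := rfl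
  simp only [horForm, h, frame_slice hc, infAct]
  fin_cases i <;>
    simp [infRot, mulVec, dotProduct, Fin.sum_univ_five] <;> ring

lemma horForm_velocity {c d : Fin 5 → ℝ} (hc : IsSlice c)
    (hd : c 1 * d 1 + c 2 * d 2 + c 3 * d 3 = 0) :
    horForm (slicePoint c) (sliceVelocity c d) =
      (√(1 - c 3 ^ 2))⁻¹ • ![0, 0, c 1 * d 2 - c 2 * d 1, d 3] := by
  ext i
  have h : (slicePoint c).1 = ![c 1, 0, 0, c 2, c 3] := rfl
  simp only [horForm, h, frame_slice hc, sliceVelocity]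
  fin_cases i <;> simp [Fin.sum_univ_five]
  · ring
  · linear_combination (-(√(1 - c 3 ^ 2))⁻¹ * c 3) * hd

lemma infAct_snd_apply (L : Matrix (Fin 5) (Fin 5) ℝ) (p : Amb) (k l : Fin 5) :
    (infAct L p).2 k l = ∑ m, L k m * p.2 m l + ∑ m, p.2 k m * L l m := by
  change (L * of p.2 + of p.2 * Lᵀ) k l = _
  simp [mul_apply]

lemma vertForm_infRot {c : Fin 5 → ℝ} (hc : IsSlice c) (ξ : Fin 3 → ℝ) :
    vertForm (slicePoint c) (infAct (infRot ξ) (slicePoint c)) =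
      ![c 0 * (c 1 * c 4 * ξ 1 + (c 3 - c 2 * c 4) * ξ 2), 0, -(c 0 * ξ 0)] := by
  have h1 := hc.sphere
  have h2 := hc.proj
  ext i
  have h : (slicePoint c).1 = ![c 1, 0, 0, c 2, c 3] := rfl
  simp only [vertForm, h, asdFrame_slice hc, infAct_snd_apply]
  fin_cases i <;>
    simp [infRot, slicePoint, Fin.sum_univ_five]
  · grind
  · grind
  · grind

lemma vertForm_velocity {c d : Fin 5 → ℝ} (hc : IsSlice c)
    (hd : c 1 * d 1 + c 2 * d 2 + c 3 * d 3 = 0)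
    (hk : d 4 * (1 - c 3) - c 4 * d 3 = d 2) :
    vertForm (slicePoint c) (sliceVelocity c d) 0 = 0 ∧
    vertForm (slicePoint c) (sliceVelocity c d) 1 = d 0 := by
  have h1 := hc.sphere
  have h2 := hc.proj
  have h : (slicePoint c).1 = ![c 1, 0, 0, c 2, c 3] := rfl
  simp only [vertForm, h, asdFrame_slice hc]
  constructor <;>
    simp [sliceVelocity, Fin.sum_univ_five]
  grind

lemma sFun_pos {lam : ℝ} (hlam : 0 < lam) (p : Amb) : 0 < sFun lam p := by
  have : 0 ≤ ∑ k, ∑ l, p.2 k l ^ 2 :=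
    Finset.sum_nonneg fun _ _ => Finset.sum_nonneg fun _ _ => sq_nonneg _
  exact Real.rpow_pos_of_pos (by positivity) _

/-- The calibration on the tangent space of the orbit of a curve of slice points is
`d (x₁ a)²`. -/
lemma starPhi_slice {lam : ℝ} (hlam : 0 < lam) {c d : Fin 5 → ℝ} (hc : IsSlice c)
    (hd : c 1 * d 1 + c 2 * d 2 + c 3 * d 3 = 0)
    (hk : d 4 * (1 - c 3) - c 4 * d 3 = d 2) (ξ : Matrix (Fin 3) (Fin 3) ℝ) :
    starPhi lam (slicePoint c) ![sliceVelocity c d, infAct (infRot (ξ 0)) (slicePoint c),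
      infAct (infRot (ξ 1)) (slicePoint c), infAct (infRot (ξ 2)) (slicePoint c)] =
      2 * (c 1 * c 0) * (d 1 * c 0 + c 1 * d 0) * ξ.det := by
  have h1 := hc.sphere
  have h2 := hc.proj
  have hn := hc.norm
  have hs := (sFun_pos hlam (slicePoint c)).ne'
  obtain ⟨v0, v1⟩ := vertForm_velocity hc hd hk
  have hv : ∀ ξ : Fin 3 → ℝ,
      adaptedCoframe lam (slicePoint c) (infAct (infRot ξ) (slicePoint c)) =
      ![c 0 * (c 1 * c 4 * ξ 1 + (c 3 - c 2 * c 4) * ξ 2) * (sFun lam (slicePoint c))⁻¹, 0,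
        -(c 0 * ξ 0) * (sFun lam (slicePoint c))⁻¹,
        √2 * sFun lam (slicePoint c) * (√(1 - c 3 ^ 2))⁻¹ * (c 1 * (c 1 * ξ 2 + c 2 * ξ 1)),
        √2 * sFun lam (slicePoint c) * (√(1 - c 3 ^ 2))⁻¹ * (c 1 * (c 2 * ξ 2 - c 1 * ξ 1)),
        0, 0] := by
    intro ξ
    simp only [adaptedCoframe, horForm_infRot hc, vertForm_infRot hc]
    ext i
    fin_cases i <;> simp [div_eq_mul_inv] <;> ring
  have hw : adaptedCoframe lam (slicePoint c) (sliceVelocity c d) =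
      ![0, d 0 * (sFun lam (slicePoint c))⁻¹,
        vertForm (slicePoint c) (sliceVelocity c d) 2 * (sFun lam (slicePoint c))⁻¹, 0, 0,
        √2 * sFun lam (slicePoint c) * (√(1 - c 3 ^ 2))⁻¹ * (c 1 * d 2 - c 2 * d 1),
        √2 * sFun lam (slicePoint c) * (√(1 - c 3 ^ 2))⁻¹ * d 3] := by
    simp only [adaptedCoframe, horForm_velocity hc hd, v0, v1]
    ext i
    fin_cases i <;> simp [div_eq_mul_inv] <;> ring
  -- Each surviving term has two horizontal and two vertical factors, so the powers of s cancel.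
  have hq : (√2 * sFun lam (slicePoint c) * (√(1 - c 3 ^ 2))⁻¹) ^ 2 *
      ((sFun lam (slicePoint c))⁻¹) ^ 2 * (1 - c 3 ^ 2) = 2 := by
    calc _ = √2 ^ 2 * (sFun lam (slicePoint c) * (sFun lam (slicePoint c))⁻¹) ^ 2 *
          ((√(1 - c 3 ^ 2))⁻¹ ^ 2 * (1 - c 3 ^ 2)) := by ring
      _ = 2 := by rw [hn, mul_inv_cancel₀ hs, Real.sq_sqrt zero_le_two]; norm_num
  rw [starPhi, starPhi0_eq]
  simp only [cons_val, hv, hw]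
  generalize √2 * sFun lam (slicePoint c) * (√(1 - c 3 ^ 2))⁻¹ = w at hq
  generalize (sFun lam (slicePoint c))⁻¹ = s at hq
  -- The third vertical component of the velocity cancels in the final sum, so its value is not
  -- needed.
  generalize vertForm (slicePoint c) (sliceVelocity c d) 2 = k
  simp only [vertPart, horPart, horPair, cross_apply, dotProduct,
    Fin.sum_univ_three, Pi.add_apply, Pi.sub_apply, Pi.smul_apply, smul_eq_mul, cons_val,
    det_fin_three]
  linear_combination
    (ξ 0 0 * ξ 1 1 * ξ 2 2 - ξ 0 0 * ξ 1 2 * ξ 2 1 - ξ 0 1 * ξ 1 0 * ξ 2 2 +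
      ξ 0 1 * ξ 1 2 * ξ 2 0 + ξ 0 2 * ξ 1 0 * ξ 2 1 - ξ 0 2 * ξ 1 1 * ξ 2 0) *
    (c 1 * c 0 * (d 1 * c 0 + c 1 * d 0) * hq + w ^ 2 * s ^ 2 *
      (c 0 * c 1 * (c 1 * d 0 + c 0 * d 1) * h1 - c 0 ^ 2 * c 1 ^ 2 * hd
        + c 0 ^ 2 * c 1 * (c 1 * d 2 - c 2 * d 1) * (-c 4 * h1 - (1 + c 3) * h2)))

/-! ### Euler angles and differentiation of the orbit map -/

/-- The rotation by `θ` about the third axis. -/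
def rotZ (θ : ℝ) : Matrix (Fin 3) (Fin 3) ℝ :=
  !![Real.cos θ, -Real.sin θ, 0; Real.sin θ, Real.cos θ, 0; 0, 0, 1]

/-- The rotation by `θ` about the first axis. -/
def rotX (θ : ℝ) : Matrix (Fin 3) (Fin 3) ℝ :=
  !![1, 0, 0; 0, Real.cos θ, -Real.sin θ; 0, Real.sin θ, Real.cos θ]

lemma rotZ_mem (θ : ℝ) : rotZ θ ∈ specialOrthogonalGroup (Fin 3) ℝ := by
  have h := Real.sin_sq_add_cos_sq θ
  refine mem_specialOrthogonalGroup_iff.2 ⟨(mem_orthogonalGroup_iff _ _).2 ?_, ?_⟩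
  · ext i j
    fin_cases i <;> fin_cases j <;> simp [rotZ, mul_apply, Fin.sum_univ_three] <;>
      linarith
  · simp [rotZ, det_fin_three]
    linarith

lemma rotX_mem (θ : ℝ) : rotX θ ∈ specialOrthogonalGroup (Fin 3) ℝ := by
  have h := Real.sin_sq_add_cos_sq θ
  refine mem_specialOrthogonalGroup_iff.2 ⟨(mem_orthogonalGroup_iff _ _).2 ?_, ?_⟩
  · ext i j
    fin_cases i <;> fin_cases j <;> simp [rotX, mul_apply, Fin.sum_univ_three] <;>
      linarith
  · simp [rotX, det_fin_three]
    linarith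

/-- The rotation with Euler angles `u 1, u 2, u 3`. -/
def euler (u : Fin 4 → ℝ) : Matrix (Fin 3) (Fin 3) ℝ := rotZ (u 3) * rotX (u 2) * rotZ (u 1)

lemma euler_mem (u : Fin 4 → ℝ) : euler u ∈ specialOrthogonalGroup (Fin 3) ℝ :=
  mul_mem (mul_mem (rotZ_mem _) (rotX_mem _)) (rotZ_mem _)

lemma euler_eq (u : Fin 4 → ℝ) : euler u =
    !![Real.cos (u 3) * Real.cos (u 1) - Real.sin (u 3) * Real.cos (u 2) * Real.sin (u 1),
       -(Real.cos (u 3) * Real.sin (u 1)) - Real.sin (u 3) * Real.cos (u 2) * Real.cos (u 1),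
       Real.sin (u 3) * Real.sin (u 2);
       Real.sin (u 3) * Real.cos (u 1) + Real.cos (u 3) * Real.cos (u 2) * Real.sin (u 1),
       -(Real.sin (u 3) * Real.sin (u 1)) + Real.cos (u 3) * Real.cos (u 2) * Real.cos (u 1),
       -(Real.cos (u 3) * Real.sin (u 2));
       Real.sin (u 2) * Real.sin (u 1), Real.sin (u 2) * Real.cos (u 1), Real.cos (u 2)] := by
  ext i j
  fin_cases i <;> fin_cases j <;>
    simp [euler, rotZ, rotX, mul_apply, Fin.sum_univ_three] <;> ring

/-- The angular velocities of the Euler angles in the body frame. -/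
def eulerVelocity (u : Fin 4 → ℝ) : Matrix (Fin 3) (Fin 3) ℝ :=
  !![0, 0, 1; Real.cos (u 1), -Real.sin (u 1), 0;
     Real.sin (u 2) * Real.sin (u 1), Real.sin (u 2) * Real.cos (u 1), Real.cos (u 2)]

lemma det_eulerVelocity (u : Fin 4 → ℝ) : (eulerVelocity u).det = Real.sin (u 2) := by
  simp [eulerVelocity, det_fin_three]
  linear_combination Real.sin (u 2) * Real.sin_sq_add_cos_sq (u 1)

lemma hasDerivAt_rotZ (θ : ℝ) (i j : Fin 5) :
    HasDerivAt (fun s => embedSO3 (rotZ s) i j)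
      ((embedSO3 (rotZ θ) * infRot ![0, 0, 1]) i j) θ := by
  fin_cases i <;> fin_cases j <;>
    simp [embedSO3, rotZ, infRot, mul_apply, Fin.sum_univ_five] <;>
    first
    | exact hasDerivAt_const _ _
    | exact Real.hasDerivAt_cos _
    | exact Real.hasDerivAt_sin _
    | exact (Real.hasDerivAt_sin _).neg

lemma hasDerivAt_rotX (θ : ℝ) (i j : Fin 5) :
    HasDerivAt (fun s => embedSO3 (rotX s) i j)
      ((embedSO3 (rotX θ) * infRot ![1, 0, 0]) i j) θ := by
  fin_cases i <;> fin_cases j <;>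
    simp [embedSO3, rotX, infRot, mul_apply, Fin.sum_univ_five] <;>
    first
    | exact hasDerivAt_const _ _
    | exact Real.hasDerivAt_cos _
    | exact Real.hasDerivAt_sin _
    | exact (Real.hasDerivAt_sin _).neg

lemma hasDerivAt_const_mul_mul {H : ℝ → Matrix (Fin 5) (Fin 5) ℝ} {H' : Matrix (Fin 5) (Fin 5) ℝ}
    {s : ℝ} (h : ∀ i j, HasDerivAt (fun s => H s i j) (H' i j) s)
    (A B : Matrix (Fin 5) (Fin 5) ℝ) (i j : Fin 5) :
    HasDerivAt (fun s => (A * H s * B) i j) ((A * H' * B) i j) s := by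
  simp only [mul_apply]
  exact HasDerivAt.fun_sum fun k _ => (HasDerivAt.fun_sum fun l _ =>
    (h l k).const_mul (A i l)).mul_const _

/-- With the generator written on the right of H, the tangent vector is the image under H of a
vector at p, so invariance of the calibration brings every computation back to the slice. -/
lemma hasDerivAt_bundleAct {H : ℝ → Matrix (Fin 5) (Fin 5) ℝ} {L : Matrix (Fin 5) (Fin 5) ℝ}
    {s : ℝ} (h : ∀ i j, HasDerivAt (fun s => H s i j) ((H s * L) i j) s) (p : Amb) :
    HasDerivAt (fun s => bundleAct (H s) p) (bundleAct (H s) (infAct L p)) s := by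
  have e : bundleAct (H s) (infAct L p) = ((H s * L) *ᵥ p.1,
      fun i j => ∑ k, ∑ l, ((H s * L) i k * p.2 k l * H s j l + H s i k * p.2 k l *
        (H s * L) j l)) := by
    rw [bundleAct_eq]
    refine Prod.ext (mulVec_mulVec p.1 (H s) L) ?_
    change H s * (L * of p.2 + of p.2 * Lᵀ) * (H s)ᵀ = _
    have e1 : H s * (L * of p.2 + of p.2 * Lᵀ) * (H s)ᵀ =
        (H s * L) * of p.2 * (H s)ᵀ + H s * of p.2 * (H s * L)ᵀ := by
      simp only [transpose_mul, Matrix.mul_add, Matrix.add_mul, Matrix.mul_assoc]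
    rw [e1]
    have e2 : ∀ A B : Matrix (Fin 5) (Fin 5) ℝ, ∀ i j, (A * of p.2 * Bᵀ) i j =
        ∑ k, ∑ l, A i k * p.2 k l * B j l := fun A B i j => by
      simp only [mul_apply, Finset.sum_mul, transpose_apply, of_apply]
      exact Finset.sum_comm
    ext i j
    simp only [Matrix.add_apply, e2, Finset.sum_add_distrib]
  rw [e]
  refine HasDerivAt.prodMk (hasDerivAt_pi.2 fun i => ?_)
    (hasDerivAt_pi.2 fun i => hasDerivAt_pi.2 fun j => ?_)
  · simp only [mulVec, dotProduct]
    exact HasDerivAt.fun_sum fun k _ => (h i k).mul_const _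
  · exact HasDerivAt.fun_sum fun k _ => HasDerivAt.fun_sum fun l _ =>
      ((h i k).mul_const _).mul (h j l)

lemma hasDerivAt_bundleAct_const {p : ℝ → Amb} {p' : Amb} {s : ℝ} (hp : HasDerivAt p p' s)
    (H : Matrix (Fin 5) (Fin 5) ℝ) :
    HasDerivAt (fun s => bundleAct H (p s)) (bundleAct H p') s := by
  have h1 : ∀ i, HasDerivAt (fun s => (p s).1 i) (p'.1 i) s := hasDerivAt_pi.1 hp.fst
  have h2 : ∀ i j, HasDerivAt (fun s => (p s).2 i j) (p'.2 i j) s := fun i =>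
    hasDerivAt_pi.1 (hasDerivAt_pi.1 hp.snd i)
  refine HasDerivAt.prodMk (hasDerivAt_pi.2 fun i => ?_)
    (hasDerivAt_pi.2 fun i => hasDerivAt_pi.2 fun j => ?_)
  · simp only [mulVec, dotProduct]
    exact HasDerivAt.fun_sum fun k _ => (h1 k).const_mul _
  · exact HasDerivAt.fun_sum fun k _ => HasDerivAt.fun_sum fun l _ =>
      ((h2 k l).const_mul _).mul_const _

lemma hasDerivAt_slicePoint {c : ℝ → Fin 5 → ℝ} {d : Fin 5 → ℝ} {t : ℝ} (h : HasDerivAt c d t) :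
    HasDerivAt (fun s => slicePoint (c s)) (sliceVelocity (c t) d) t := by
  have hi := hasDerivAt_pi.1 h
  have a1 := (hi 0).mul ((hi 1).mul (hi 4))
  have a2 := (hi 0).mul ((hi 3).sub ((hi 2).mul (hi 4)))
  have a3 := (hi 0).mul (((hi 2).mul (hi 4)).const_sub 1)
  have a4 := (hi 0).mul (hi 2)
  have a5 := (hi 0).mul (hi 1)
  have e : d 0 * (1 - c t 2 * c t 4) - c t 0 * (d 2 * c t 4 + c t 2 * d 4) =
      d 0 * (1 - c t 2 * c t 4) + c t 0 * -(d 2 * c t 4 + c t 2 * d 4) := by ring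
  refine HasDerivAt.prodMk (hasDerivAt_pi.2 fun i => ?_)
    (hasDerivAt_pi.2 fun i => hasDerivAt_pi.2 fun j => ?_)
  · fin_cases i
    exacts [hi 1, hasDerivAt_const _ _, hasDerivAt_const _ _, hi 2, hi 3]
  · simp only [e]
    fin_cases i <;> fin_cases j <;>
    first
    | exact hasDerivAt_const _ _
    | exact a1
    | exact a2
    | exact a3
    | exact a4
    | exact a5
    | exact a1.neg
    | exact a2.neg
    | exact a3.neg
    | exact a4.neg
    | exact a5.neg

/-- The parametrization of the orbits of slice points. -/
def orbitMap (q : (Fin 5 → ℝ) × (Fin 4 → ℝ)) : Amb :=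
  bundleAct (embedSO3 (euler q.2)) (slicePoint q.1)

lemma contDiff_orbitMap : ContDiff ℝ ∞ orbitMap := by
  have hE : ∀ i j, ContDiff ℝ ∞ fun q : (Fin 5 → ℝ) × (Fin 4 → ℝ) =>
      embedSO3 (euler q.2) i j := by
    intro i j
    simp only [euler_eq]
    fin_cases i <;> fin_cases j <;> simp [embedSO3] <;> fun_prop
  have h1 : ∀ i, ContDiff ℝ ∞ fun q : (Fin 5 → ℝ) × (Fin 4 → ℝ) => (slicePoint q.1).1 i := by
    intro i
    fin_cases i <;> simp [slicePoint] <;> fun_prop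
  have h2 : ∀ i j, ContDiff ℝ ∞ fun q : (Fin 5 → ℝ) × (Fin 4 → ℝ) =>
      (slicePoint q.1).2 i j := by
    intro i j
    fin_cases i <;> fin_cases j <;> simp [slicePoint] <;> fun_prop
  refine ContDiff.prodMk (contDiff_pi.2 fun i => ?_)
    (contDiff_pi.2 fun i => contDiff_pi.2 fun j => ?_)
  · simp only [mulVec, dotProduct]
    exact ContDiff.sum fun k _ => (hE i k).mul (h1 k)
  · exact ContDiff.sum fun k _ => ContDiff.sum fun l _ => ((hE i k).mul (h2 k l)).mul (hE j l)

/-! ### The curve of slice points and its bounds -/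

/-- The value of `√(λ + r²)` along the curve of slice points. -/
def radius (lam ε η t : ℝ) : ℝ := max √lam (ε ^ 2 + η ^ 2) + t ^ 2

/-- The curve of slice points `(a, x₁, x₄, x₅, κ)` with `x₄ = ε (λ + r²)^{-1/4}` and
`x₅ = η (λ + r²)^{-1/4}`. -/
def curve (lam ε η t : ℝ) : Fin 5 → ℝ :=
  ![√(radius lam ε η t ^ 2 - lam), √(1 - (ε ^ 2 + η ^ 2) / radius lam ε η t),
    ε * (√(radius lam ε η t))⁻¹, η * (√(radius lam ε η t))⁻¹,
    ε * (√(radius lam ε η t))⁻¹ / (1 - η * (√(radius lam ε η t))⁻¹)]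

/-- The derivative of `curve` in `t`. -/
def curveDeriv (lam ε η t : ℝ) : Fin 5 → ℝ :=
  ![2 * radius lam ε η t * t / √(radius lam ε η t ^ 2 - lam),
    (ε ^ 2 + η ^ 2) * t / (radius lam ε η t ^ 2 * √(1 - (ε ^ 2 + η ^ 2) / radius lam ε η t)),
    ε * (√(radius lam ε η t))⁻¹ * (-t / radius lam ε η t),
    η * (√(radius lam ε η t))⁻¹ * (-t / radius lam ε η t),
    ε * (√(radius lam ε η t))⁻¹ * (-t / radius lam ε η t) /
      (1 - η * (√(radius lam ε η t))⁻¹) ^ 2]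

section
variable {lam ε η t : ℝ}

lemma sqrt_lam_add_le_radius : √lam + t ^ 2 ≤ radius lam ε η t :=
  add_le_add_left (le_max_left _ _) _

lemma sum_sq_add_le_radius : ε ^ 2 + η ^ 2 + t ^ 2 ≤ radius lam ε η t :=
  add_le_add_left (le_max_right _ _) _

lemma radius_pos (hlam : 0 < lam) : 0 < radius lam ε η t :=
  lt_of_lt_of_le (by positivity) (sqrt_lam_add_le_radius (lam := lam) (ε := ε) (η := η) (t := t))

lemma inv_sqrt_radius_sq (hlam : 0 < lam) :
    (√(radius lam ε η t))⁻¹ ^ 2 = (radius lam ε η t)⁻¹ := by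
  rw [inv_pow, Real.sq_sqrt (radius_pos hlam).le]

/-- With z the radius, factor z² - λ = (z - √λ)(z + √λ), where z - √λ ≥ t². This lower bound for a²
is what keeps the velocity of a bounded as t → 0. -/
lemma radius_mul_sq_le (hlam : 0 < lam) :
    radius lam ε η t * t ^ 2 ≤ radius lam ε η t ^ 2 - lam := by
  have h1 := sqrt_lam_add_le_radius (lam := lam) (ε := ε) (η := η) (t := t)
  have h2 := Real.sq_sqrt hlam.le
  have h3 := Real.sqrt_pos.2 hlam
  nlinarith [sq_nonneg t]

/-- The corresponding lower bound for x₁². -/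
lemma sq_div_radius_le (hlam : 0 < lam) :
    t ^ 2 / radius lam ε η t ≤ 1 - (ε ^ 2 + η ^ 2) / radius lam ε η t := by
  have h1 := sum_sq_add_le_radius (lam := lam) (ε := ε) (η := η) (t := t)
  have h2 := radius_pos (ε := ε) (η := η) (t := t) hlam
  rw [le_sub_iff_add_le, ← add_div, div_le_one h2]
  linarith

lemma curve_sq_pos (hlam : 0 < lam) (ht : 0 < t) : 0 < radius lam ε η t ^ 2 - lam :=
  lt_of_lt_of_le (mul_pos (radius_pos hlam) (by positivity)) (radius_mul_sq_le hlam)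

lemma one_sub_div_radius_pos (hlam : 0 < lam) (ht : 0 < t) :
    0 < 1 - (ε ^ 2 + η ^ 2) / radius lam ε η t :=
  lt_of_lt_of_le (div_pos (by positivity) (radius_pos hlam)) (sq_div_radius_le hlam)

lemma curve_zero_pos (hlam : 0 < lam) (ht : 0 < t) : 0 < curve lam ε η t 0 :=
  Real.sqrt_pos.2 (curve_sq_pos hlam ht)

lemma curve_one_pos (hlam : 0 < lam) (ht : 0 < t) : 0 < curve lam ε η t 1 :=
  Real.sqrt_pos.2 (one_sub_div_radius_pos hlam ht)

lemma curve_zero_sq (hlam : 0 < lam) (ht : 0 < t) :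
    curve lam ε η t 0 ^ 2 = radius lam ε η t ^ 2 - lam :=
  Real.sq_sqrt (curve_sq_pos hlam ht).le

lemma curve_sphere (hlam : 0 < lam) (ht : 0 < t) :
    curve lam ε η t 1 ^ 2 + curve lam ε η t 2 ^ 2 + curve lam ε η t 3 ^ 2 = 1 := by
  have h1 : curve lam ε η t 1 ^ 2 = 1 - (ε ^ 2 + η ^ 2) / radius lam ε η t :=
    Real.sq_sqrt (one_sub_div_radius_pos hlam ht).le
  have h2 : curve lam ε η t 2 = ε * (√(radius lam ε η t))⁻¹ := rfl
  have h3 : curve lam ε η t 3 = η * (√(radius lam ε η t))⁻¹ := rfl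
  rw [h1, h2, h3, mul_pow, mul_pow, inv_sqrt_radius_sq hlam]
  ring

lemma curve_three_sq_lt (hlam : 0 < lam) (ht : 0 < t) : curve lam ε η t 3 ^ 2 < 1 := by
  have h1 := curve_sphere (ε := ε) (η := η) hlam ht
  have h2 := curve_one_pos (ε := ε) (η := η) hlam ht
  nlinarith [sq_nonneg (curve lam ε η t 2)]

lemma one_sub_curve_three_pos (hlam : 0 < lam) (ht : 0 < t) :
    0 < 1 - η * (√(radius lam ε η t))⁻¹ :=
  sub_pos.2 (lt_of_abs_lt ((sq_lt_one_iff_abs_lt_one _).1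
    (curve_three_sq_lt (ε := ε) (η := η) hlam ht)))

lemma isSlice_curve (hlam : 0 < lam) (ht : 0 < t) : IsSlice (curve lam ε η t) where
  sphere := curve_sphere hlam ht
  proj := div_mul_cancel₀ _ (one_sub_curve_three_pos hlam ht).ne'
  nonpole := (curve_three_sq_lt hlam ht).ne

lemma hasDerivAt_radius : HasDerivAt (radius lam ε η) (2 * t) t := by
  exact ((hasDerivAt_pow 2 t).const_add (max √lam (ε ^ 2 + η ^ 2))).congr_deriv (by simp)

lemma hasDerivAt_inv_sqrt_radius (hlam : 0 < lam) :
    HasDerivAt (fun t => (√(radius lam ε η t))⁻¹)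
      ((√(radius lam ε η t))⁻¹ * (-t / radius lam ε η t)) t := by
  have hz := radius_pos (ε := ε) (η := η) (t := t) hlam
  have h := (hasDerivAt_radius (lam := lam) (ε := ε) (η := η) (t := t)).sqrt hz.ne'
  refine (h.inv (Real.sqrt_pos.2 hz).ne').congr_deriv ?_
  rw [Real.sq_sqrt hz.le]
  have := (Real.sqrt_pos.2 hz).ne'
  field_simp

lemma hasDerivAt_curve (hlam : 0 < lam) (ht : 0 < t) :
    HasDerivAt (curve lam ε η) (curveDeriv lam ε η t) t := by
  have hz := radius_pos (ε := ε) (η := η) (t := t) hlam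
  have hr := hasDerivAt_radius (lam := lam) (ε := ε) (η := η) (t := t)
  have hy := hasDerivAt_inv_sqrt_radius (ε := ε) (η := η) (t := t) hlam
  have h5 := one_sub_curve_three_pos (ε := ε) (η := η) hlam ht
  have p0 := curve_sq_pos (ε := ε) (η := η) hlam ht
  have p1 := one_sub_div_radius_pos (ε := ε) (η := η) hlam ht
  rw [hasDerivAt_pi]
  intro i
  fin_cases i
  · have h := ((hr.pow 2).sub_const lam).sqrt p0.ne'
    refine h.congr_deriv ?_
    simp [curveDeriv]
    ring
  · have h := (((hasDerivAt_const t (ε ^ 2 + η ^ 2)).div hr hz.ne').const_sub 1).sqrt p1.ne'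
    refine h.congr_deriv ?_
    simp [curveDeriv]
    have := (Real.sqrt_pos.2 p1).ne'
    field_simp
  · simpa [curve, curveDeriv, mul_assoc] using hy.const_mul ε
  · simpa [curve, curveDeriv, mul_assoc] using hy.const_mul η
  · have h := (hy.const_mul ε).div ((hy.const_mul η).const_sub 1) h5.ne'
    refine h.congr_deriv ?_
    simp [curveDeriv]
    congr 1
    ring

/-- The sphere equation holds at all nearby parameters, so it can be differentiated;
`curveDeriv_proj` does the same with the equation for κ. -/
lemma curve_mul_curveDeriv (hlam : 0 < lam) (ht : 0 < t) :
    curve lam ε η t 1 * curveDeriv lam ε η t 1 + curve lam ε η t 2 * curveDeriv lam ε η t 2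
      + curve lam ε η t 3 * curveDeriv lam ε η t 3 = 0 := by
  have h := hasDerivAt_pi.1 (hasDerivAt_curve (ε := ε) (η := η) hlam ht)
  have h1 := (((h 1).pow 2).add ((h 2).pow 2)).add ((h 3).pow 2)
  have h2 := (hasDerivAt_const t (1 : ℝ)).congr_of_eventuallyEq
    ((eventually_gt_nhds ht).mono fun s hs => curve_sphere (ε := ε) (η := η) hlam hs)
  have h3 := h1.unique h2
  simp at h3
  linarith

lemma curveDeriv_proj (hlam : 0 < lam) (ht : 0 < t) :
    curveDeriv lam ε η t 4 * (1 - curve lam ε η t 3) -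
      curve lam ε η t 4 * curveDeriv lam ε η t 3 = curveDeriv lam ε η t 2 := by
  have h := hasDerivAt_pi.1 (hasDerivAt_curve (ε := ε) (η := η) hlam ht)
  have h1 := (h 4).mul ((h 3).const_sub 1)
  have h2 := (h 2).congr_of_eventuallyEq
    ((eventually_gt_nhds ht).mono fun s hs => (isSlice_curve (ε := ε) (η := η) hlam hs).proj)
  have h3 := h1.unique h2
  linarith

lemma curveDeriv_zero_pos (hlam : 0 < lam) (ht : 0 < t) : 0 < curveDeriv lam ε η t 0 :=
  div_pos (mul_pos (mul_pos two_pos (radius_pos hlam)) ht) (Real.sqrt_pos.2 (curve_sq_pos hlam ht))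

lemma curveDeriv_one_nonneg (ht : 0 < t) : 0 ≤ curveDeriv lam ε η t 1 :=
  div_nonneg (mul_nonneg (by positivity) ht.le) (by positivity)

lemma contDiffOn_curve (hlam : 0 < lam) : ContDiffOn ℝ ∞ (curve lam ε η) (Set.Ioi 0) := by
  have hr : ContDiff ℝ ∞ (radius lam ε η) := by
    unfold radius
    fun_prop
  have hs : ContDiffOn ℝ ∞ (fun t => (√(radius lam ε η t))⁻¹) (Set.Ioi 0) :=
    (hr.contDiffOn.sqrt fun t _ => (radius_pos hlam).ne').inv
      fun t _ => (Real.sqrt_pos.2 (radius_pos hlam)).ne'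
  rw [contDiffOn_pi]
  intro i
  fin_cases i
  · exact ((hr.contDiffOn.pow 2).sub contDiffOn_const).sqrt fun t ht => (curve_sq_pos hlam ht).ne'
  · exact (contDiffOn_const.sub (contDiffOn_const.div hr.contDiffOn
      fun t _ => (radius_pos hlam).ne')).sqrt fun t ht => (one_sub_div_radius_pos hlam ht).ne'
  · exact contDiffOn_const.mul hs
  · exact contDiffOn_const.mul hs
  · exact (contDiffOn_const.mul hs).div (contDiffOn_const.sub (contDiffOn_const.mul hs))
      fun t ht => (one_sub_curve_three_pos hlam ht).ne'

/-- The maximum is not smooth where ε² + η² = √λ, but continuity in the parameters is all the limit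
requires. -/
lemma continuousAt_radius (q : ℝ × ℝ) :
    ContinuousAt (fun q : ℝ × ℝ => radius lam q.1 q.2 t) q := by
  unfold radius
  fun_prop

lemma continuousAt_inv_sqrt_radius (hlam : 0 < lam) (q : ℝ × ℝ) :
    ContinuousAt (fun q : ℝ × ℝ => (√(radius lam q.1 q.2 t))⁻¹) q :=
  (continuousAt_radius q).sqrt.inv₀ (Real.sqrt_pos.2 (radius_pos hlam)).ne'

lemma continuousAt_curve (hlam : 0 < lam) (ht : 0 < t) (q : ℝ × ℝ) :
    ContinuousAt (fun q : ℝ × ℝ => curve lam q.1 q.2 t) q := by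
  have hr := continuousAt_radius (lam := lam) (t := t) q
  have hs := continuousAt_inv_sqrt_radius (t := t) hlam q
  have hm : ContinuousAt (fun q : ℝ × ℝ => q.1 ^ 2 + q.2 ^ 2) q := by fun_prop
  have hz := (radius_pos (lam := lam) (ε := q.1) (η := q.2) (t := t) hlam).ne'
  rw [continuousAt_pi]
  intro i
  fin_cases i
  · exact ((hr.pow 2).sub continuousAt_const).sqrt
  · exact (continuousAt_const.sub (hm.div hr hz)).sqrt
  · exact continuousAt_fst.mul hs
  · exact continuousAt_snd.mul hs
  · exact (continuousAt_fst.mul hs).div (continuousAt_const.sub (continuousAt_snd.mul hs))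
      (one_sub_curve_three_pos hlam ht).ne'

lemma continuousAt_curveDeriv (hlam : 0 < lam) (ht : 0 < t) (q : ℝ × ℝ) :
    ContinuousAt (fun q : ℝ × ℝ => curveDeriv lam q.1 q.2 t) q := by
  have hr := continuousAt_radius (lam := lam) (t := t) q
  have hs := continuousAt_inv_sqrt_radius (t := t) hlam q
  have hm : ContinuousAt (fun q : ℝ × ℝ => q.1 ^ 2 + q.2 ^ 2) q := by fun_prop
  have hz := (radius_pos (lam := lam) (ε := q.1) (η := q.2) (t := t) hlam).ne'
  have ht' : ContinuousAt (fun q : ℝ × ℝ => -t / radius lam q.1 q.2 t) q :=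
    continuousAt_const.div hr hz
  rw [continuousAt_pi]
  intro i
  fin_cases i
  · exact ((continuousAt_const.mul hr).mul continuousAt_const).div
      ((hr.pow 2).sub continuousAt_const).sqrt (curve_zero_pos hlam ht).ne'
  · exact (hm.mul continuousAt_const).div
      ((hr.pow 2).mul (continuousAt_const.sub (hm.div hr hz)).sqrt)
      (mul_ne_zero (pow_ne_zero 2 hz) (curve_one_pos hlam ht).ne')
  · exact (continuousAt_fst.mul hs).mul ht'
  · exact (continuousAt_snd.mul hs).mul ht'
  · exact ((continuousAt_fst.mul hs).mul ht').div
      ((continuousAt_const.sub (continuousAt_snd.mul hs)).pow 2)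
      (pow_ne_zero 2 (one_sub_curve_three_pos hlam ht).ne')

end

set_option maxHeartbeats 1000000 in
/-- The curve and its derivative are bounded on bounded intervals, uniformly in the parameters. -/
lemma exists_bound_curve {lam : ℝ} (hlam : 0 < lam) (R l δ : ℝ) (hδ : 0 < δ) :
    ∃ K, ∀ ε η t, |ε| ≤ l → |η| ≤ l → (ε = 0 ∨ δ ≤ |ε|) → 0 < t → t ≤ R →
      (∀ i, |curve lam ε η t i| ≤ K) ∧ ∀ i, |curveDeriv lam ε η t i| ≤ K := by
  -- Z bounds the radius, A bounds 1 / (1 - x₅) when |ε| ≥ δ, and B bounds t divided by the radius.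
  obtain ⟨Z, hZ⟩ : ∃ Z, Z = √lam + 2 * l ^ 2 + R ^ 2 := ⟨_, rfl⟩
  obtain ⟨A, hA⟩ : ∃ A, A = 4 * l ^ 2 / δ ^ 2 := ⟨_, rfl⟩
  have hsl := Real.sqrt_pos.2 hlam
  have hA0 : 0 ≤ A := by rw [hA]; positivity
  have hZ0 : 0 ≤ Z := by rw [hZ]; positivity
  have hs0 : 0 ≤ √Z := Real.sqrt_nonneg _
  have hl0 : 0 ≤ (√√lam)⁻¹ := by positivity
  obtain ⟨B, hB⟩ : ∃ B, B = |R| / √lam := ⟨_, rfl⟩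
  have hB0 : 0 ≤ B := by rw [hB]; positivity
  have hBA : 0 ≤ B * A ^ 2 := by positivity
  refine ⟨Z + 1 + 2 * √Z + (√√lam)⁻¹ + B + A + B * A ^ 2, fun ε η t hε hη hεδ ht htR => ?_⟩
  have hz := radius_pos (ε := ε) (η := η) (t := t) hlam
  have hsz := Real.sqrt_pos.2 hz
  have hz1 := sqrt_lam_add_le_radius (lam := lam) (ε := ε) (η := η) (t := t)
  have hz2 := sum_sq_add_le_radius (lam := lam) (ε := ε) (η := η) (t := t)
  have hεl : ε ^ 2 ≤ l ^ 2 := sq_le_sq' (by linarith [neg_abs_le ε]) (by linarith [le_abs_self ε])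
  have hηl : η ^ 2 ≤ l ^ 2 := sq_le_sq' (by linarith [neg_abs_le η]) (by linarith [le_abs_self η])
  have hzZ : radius lam ε η t ≤ Z := by
    have : max √lam (ε ^ 2 + η ^ 2) ≤ √lam + 2 * l ^ 2 :=
      max_le (by nlinarith) (by linarith)
    have : t ^ 2 ≤ R ^ 2 := by nlinarith
    rw [radius, hZ]
    linarith
  have hsph := curve_sphere (ε := ε) (η := η) hlam ht
  have e1 := curve_one_pos (ε := ε) (η := η) hlam ht
  have b1 : |curve lam ε η t 1| ≤ 1 := by
    have h1 := sq_nonneg (curve lam ε η t 2)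
    have h2 := sq_nonneg (curve lam ε η t 3)
    exact abs_le_one_iff_mul_self_le_one.2 (by linarith)
  have b2 : |curve lam ε η t 2| ≤ 1 := by
    have h1 := sq_nonneg (curve lam ε η t 1)
    have h2 := sq_nonneg (curve lam ε η t 3)
    exact abs_le_one_iff_mul_self_le_one.2 (by linarith)
  have b3 : |curve lam ε η t 3| ≤ 1 := by
    have h1 := sq_nonneg (curve lam ε η t 2)
    have h2 := sq_nonneg (curve lam ε η t 1)
    exact abs_le_one_iff_mul_self_le_one.2 (by linarith)
  have b0 : |curve lam ε η t 0| ≤ Z := by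
    rw [abs_of_pos (curve_zero_pos hlam ht)]
    refine le_trans ?_ hzZ
    exact Real.sqrt_le_iff.2 ⟨hz.le, by linarith⟩
  have htB : |-t / radius lam ε η t| ≤ B := by
    rw [abs_div, abs_neg, abs_of_pos ht, abs_of_pos hz, hB]
    exact div_le_div₀ (abs_nonneg _) (htR.trans (le_abs_self R)) hsl (by nlinarith)
  have h5 := one_sub_curve_three_pos (ε := ε) (η := η) hlam ht
  have hkap : ε = 0 ∨ (1 - η * (√(radius lam ε η t))⁻¹)⁻¹ ≤ A := by
    refine hεδ.imp_right fun h => ?_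
    have hε0 : 0 < ε ^ 2 := by
      have : 0 < |ε| := hδ.trans_le h
      rw [← sq_abs]; positivity
    have hδε : δ ^ 2 ≤ ε ^ 2 := by rw [← sq_abs ε]; exact pow_le_pow_left₀ hδ.le h 2
    have hl : 0 < l ^ 2 := by linarith
    -- Since the radius is at least ε² + η², x₅² ≤ η² / (ε² + η²); with |ε| ≥ δ this keeps x₅ away
    -- from 1.
    have hx : (η * (√(radius lam ε η t))⁻¹) ^ 2 * (ε ^ 2 + η ^ 2) ≤ η ^ 2 := by
      rw [mul_pow, inv_sqrt_radius_sq hlam, mul_assoc]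
      refine mul_le_of_le_one_right (sq_nonneg _) ?_
      rw [inv_mul_le_one₀ hz]
      nlinarith
    have hx3 : (η * (√(radius lam ε η t))⁻¹) ^ 2 < 1 := curve_three_sq_lt hlam ht
    generalize η * (√(radius lam ε η t))⁻¹ = x at h5 hx hx3
    have hx4 : -1 < x := (abs_lt.1 ((sq_lt_one_iff_abs_lt_one _).1 hx3)).1
    rw [hA, inv_le_comm₀ h5 (by positivity), inv_div, div_le_iff₀ (by positivity)]
    have h6 : ε ^ 2 ≤ (1 - x ^ 2) * (ε ^ 2 + η ^ 2) := by linarith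
    have h7 : (1 - x ^ 2) * (ε ^ 2 + η ^ 2) ≤ (1 - x ^ 2) * (2 * l ^ 2) :=
      mul_le_mul_of_nonneg_left (by linarith) (by linarith)
    have h8 : (1 - x) * (1 + x) * (2 * l ^ 2) ≤ (1 - x) * 2 * (2 * l ^ 2) :=
      mul_le_mul_of_nonneg_right (mul_le_mul_of_nonneg_left (by linarith) h5.le) (by positivity)
    linarith
  refine ⟨fun i => ?_, fun i => ?_⟩
  · fin_cases i
    · exact b0.trans (by linarith)
    · exact b1.trans (by linarith)
    · exact b2.trans (by linarith)
    · exact b3.trans (by linarith)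
    · refine le_trans (?_ : _ ≤ A) (by linarith)
      change |curve lam ε η t 2 / (1 - η * (√(radius lam ε η t))⁻¹)| ≤ A
      rcases hkap with h | h
      · have : curve lam ε η t 2 = 0 := by simp [curve, h]
        rw [this]
        simpa using hA0
      · rw [div_eq_mul_inv, abs_mul, abs_of_pos (inv_pos.2 h5)]
        exact (mul_le_of_le_one_left (inv_pos.2 h5).le b2).trans h
  · fin_cases i
    · refine le_trans (?_ : _ ≤ 2 * √Z) (by linarith)
      change |curveDeriv lam ε η t 0| ≤ _
      rw [abs_of_pos (curveDeriv_zero_pos hlam ht)]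
      refine le_trans ?_ (mul_le_mul_of_nonneg_left (Real.sqrt_le_sqrt hzZ) zero_le_two)
      refine (div_le_iff₀ (Real.sqrt_pos.2 (curve_sq_pos hlam ht))).2 ?_
      rw [mul_assoc, mul_assoc, ← Real.sqrt_mul hz.le]
      refine mul_le_mul_of_nonneg_left (Real.le_sqrt_of_sq_le ?_) zero_le_two
      have := mul_le_mul_of_nonneg_left
        (radius_mul_sq_le (lam := lam) (ε := ε) (η := η) (t := t) hlam) hz.le
      nlinarith
    · refine le_trans (?_ : _ ≤ (√√lam)⁻¹) (by linarith)
      change |curveDeriv lam ε η t 1| ≤ _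
      rw [abs_of_nonneg (curveDeriv_one_nonneg ht)]
      -- With z the radius, x₁ ≥ t / √z and ε² + η² ≤ z give x₁' ≤ z^{-1/2}: the factor t cancels.
      have h1 : t / √(radius lam ε η t) ≤ curve lam ε η t 1 := by
        refine Real.le_sqrt_of_sq_le ?_
        rw [div_pow, Real.sq_sqrt hz.le]
        exact sq_div_radius_le hlam
      have h2 : (√(radius lam ε η t))⁻¹ ≤ (√√lam)⁻¹ :=
        inv_anti₀ (Real.sqrt_pos.2 hsl) (Real.sqrt_le_sqrt (by nlinarith))
      refine le_trans ?_ h2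
      refine (div_le_iff₀ (mul_pos (pow_pos hz 2) e1)).2 ?_
      have h3 := Real.sq_sqrt hz.le
      have h4 : (√(radius lam ε η t))⁻¹ * (radius lam ε η t ^ 2 * curve lam ε η t 1) ≥
          (√(radius lam ε η t))⁻¹ * (radius lam ε η t ^ 2 * (t / √(radius lam ε η t))) := by
        gcongr
      have h6 : (√(radius lam ε η t))⁻¹ * (radius lam ε η t ^ 2 * (t / √(radius lam ε η t))) =
          radius lam ε η t * t := by
        rw [div_eq_mul_inv]
        calc _ = (√(radius lam ε η t))⁻¹ ^ 2 * radius lam ε η t ^ 2 * t := by ring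
          _ = _ := by rw [inv_sqrt_radius_sq hlam]; field_simp
      rw [h6] at h4
      refine le_trans ?_ h4
      exact mul_le_mul_of_nonneg_right (by nlinarith) ht.le
    · refine le_trans (?_ : _ ≤ B) (by linarith)
      change |curve lam ε η t 2 * (-t / radius lam ε η t)| ≤ B
      rw [abs_mul]
      exact (mul_le_of_le_one_left (abs_nonneg _) b2).trans htB
    · refine le_trans (?_ : _ ≤ B) (by linarith)
      change |curve lam ε η t 3 * (-t / radius lam ε η t)| ≤ B
      rw [abs_mul]
      exact (mul_le_of_le_one_left (abs_nonneg _) b3).trans htB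
    · refine le_trans (?_ : _ ≤ B * A ^ 2) (by linarith)
      change |curve lam ε η t 2 * (-t / radius lam ε η t) /
        (1 - η * (√(radius lam ε η t))⁻¹) ^ 2| ≤ _
      rcases hkap with h | h
      · have : curve lam ε η t 2 = 0 := by simp [curve, h]
        rw [this]
        simpa using hBA
      · rw [div_eq_mul_inv, abs_mul, abs_mul, ← inv_pow, abs_pow, abs_of_pos (inv_pos.2 h5)]
        refine mul_le_mul ((mul_le_of_le_one_left (abs_nonneg _) b2).trans htB)
          (pow_le_pow_left₀ (inv_pos.2 h5).le h 2) (by positivity) hB0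

/-! ### The sheets and their orientation -/

/-- The parametrization of a component of the regular part of `M_{C,D,0}` with `C = ε ^ 4` and
`D = η ^ 4`. -/
def sheet (lam ε η : ℝ) (u : Fin 4 → ℝ) : Amb := orbitMap (curve lam ε η (u 0), u)

/-- The half line times the full range of the Euler angles. -/
def eulerBox : Set (Fin 4 → ℝ) :=
  {u | 0 < u 0 ∧ (0 < u 1 ∧ u 1 < 2 * Real.pi) ∧ (0 < u 2 ∧ u 2 < Real.pi) ∧
    (0 < u 3 ∧ u 3 < 2 * Real.pi)}

lemma isOpen_eulerBox : IsOpen eulerBox := by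
  unfold eulerBox
  refine IsOpen.and ?_ (IsOpen.and (IsOpen.and ?_ ?_) (IsOpen.and (IsOpen.and ?_ ?_)
    (IsOpen.and ?_ ?_))) <;> exact isOpen_lt (by fun_prop) (by fun_prop)

section
variable {lam ε η : ℝ}

lemma contDiffOn_sheet (hlam : 0 < lam) : ContDiffOn ℝ ∞ (sheet lam ε η) {u | 0 < u 0} := by
  refine contDiff_orbitMap.comp_contDiffOn (ContDiffOn.prodMk ?_ contDiffOn_id)
  exact (contDiffOn_curve hlam).comp (contDiff_apply ℝ ℝ (0 : Fin 4)).contDiffOn fun u hu => hu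

lemma differentiableAt_sheet (hlam : 0 < lam) {u : Fin 4 → ℝ} (hu : 0 < u 0) :
    DifferentiableAt ℝ (sheet lam ε η) u :=
  ((contDiffOn_sheet hlam).contDiffAt ((isOpen_lt continuous_const (continuous_apply 0)).mem_nhds
    hu)).differentiableAt (by simp)

lemma coordTangent_eq_of_hasDerivAt {F : (Fin 4 → ℝ) → Amb} {u : Fin 4 → ℝ}
    (hF : DifferentiableAt ℝ F u) {i : Fin 4} {w : Amb}
    (h : HasDerivAt (fun s => F (Function.update u i s)) w (u i)) : coordTangent F u i = w := by
  refine HasDerivAt.unique ?_ h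
  have h1 := hF.hasFDerivAt
  rw [← Function.update_eq_self i u] at h1
  have h2 := h1.comp_hasDerivAt (u i) (hasDerivAt_update u i (u i))
  rw [Function.update_eq_self] at h2
  exact h2

/-- Moving a generator past a rotation turns its axis by the inverse rotation; this yields the
angular velocities in the body frame. -/
lemma infRot_mul_rotX (θ : ℝ) : infRot ![0, 0, 1] * embedSO3 (rotX θ) =
    embedSO3 (rotX θ) * infRot ![0, Real.sin θ, Real.cos θ] := by
  have h := Real.sin_sq_add_cos_sq θ
  ext i j
  fin_cases i <;> fin_cases j <;>
    simp [embedSO3, rotX, infRot, mul_apply, Fin.sum_univ_five] <;> linarith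

lemma infRot_mul_rotZ (θ : ℝ) (ξ : Fin 3 → ℝ) : infRot ξ * embedSO3 (rotZ θ) =
    embedSO3 (rotZ θ) * infRot ![Real.cos θ * ξ 0 + Real.sin θ * ξ 1,
      -Real.sin θ * ξ 0 + Real.cos θ * ξ 1, ξ 2] := by
  have h := Real.sin_sq_add_cos_sq θ
  ext i j
  fin_cases i <;> fin_cases j <;>
    simp [embedSO3, rotZ, infRot, mul_apply, Fin.sum_univ_five] <;> grind

lemma coordTangent_sheet (hlam : 0 < lam) {u : Fin 4 → ℝ} (hu : 0 < u 0) :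
    coordTangent (sheet lam ε η) u = fun n => bundleAct (embedSO3 (euler u))
      ((![sliceVelocity (curve lam ε η (u 0)) (curveDeriv lam ε η (u 0)),
        infAct (infRot (eulerVelocity u 0)) (slicePoint (curve lam ε η (u 0))),
        infAct (infRot (eulerVelocity u 1)) (slicePoint (curve lam ε η (u 0))),
        infAct (infRot (eulerVelocity u 2)) (slicePoint (curve lam ε η (u 0)))] : Fin 4 → Amb) n) := by
  have hF := differentiableAt_sheet (ε := ε) (η := η) hlam hu
  ext1 n
  refine coordTangent_eq_of_hasDerivAt hF ?_
  fin_cases n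
  · exact hasDerivAt_bundleAct_const (hasDerivAt_slicePoint
      (hasDerivAt_curve (ε := ε) (η := η) hlam hu)) (embedSO3 (euler u))
  -- The trivial factor 1 brings the derivative into the form required by
  -- `hasDerivAt_const_mul_mul`.
  · have h : ∀ i j, HasDerivAt
        (fun s => (embedSO3 (rotZ (u 3) * rotX (u 2)) * embedSO3 (rotZ s) * (1 : Matrix (Fin 5) (Fin 5) ℝ)) i j)
        ((embedSO3 (rotZ (u 3) * rotX (u 2)) * embedSO3 (rotZ (u 1)) * (1 : Matrix (Fin 5) (Fin 5) ℝ) *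
          infRot (eulerVelocity u 0)) i j) (u 1) := fun i j => by
      refine (hasDerivAt_const_mul_mul (hasDerivAt_rotZ (u 1)) _ 1 i j).congr_deriv ?_
      simp only [Matrix.mul_one, Matrix.mul_assoc]
      rfl
    have h2 := hasDerivAt_bundleAct h (slicePoint (curve lam ε η (u 0)))
    simp only [Matrix.mul_one, ← embedSO3_mul] at h2
    exact h2
  · have h : ∀ i j, HasDerivAt
        (fun s => (embedSO3 (rotZ (u 3)) * embedSO3 (rotX s) * embedSO3 (rotZ (u 1))) i j)
        ((embedSO3 (rotZ (u 3)) * embedSO3 (rotX (u 2)) * embedSO3 (rotZ (u 1)) *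
          infRot (eulerVelocity u 1)) i j) (u 2) := fun i j => by
      refine (hasDerivAt_const_mul_mul (hasDerivAt_rotX (u 2)) _ _ i j).congr_deriv ?_
      have : eulerVelocity u 1 = ![Real.cos (u 1) * ![1, 0, 0] 0 + Real.sin (u 1) *
          (![1, 0, 0] : Fin 3 → ℝ) 1, -Real.sin (u 1) * ![1, 0, 0] 0 + Real.cos (u 1) *
          (![1, 0, 0] : Fin 3 → ℝ) 1, (![1, 0, 0] : Fin 3 → ℝ) 2] := by
        ext i; fin_cases i <;> simp [eulerVelocity]
      rw [this, Matrix.mul_assoc _ _ (infRot _), ← infRot_mul_rotZ]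
      simp only [Matrix.mul_assoc]
    have h2 := hasDerivAt_bundleAct h (slicePoint (curve lam ε η (u 0)))
    simp only [← embedSO3_mul] at h2
    exact h2
  · have h : ∀ i j, HasDerivAt
        (fun s => ((1 : Matrix (Fin 5) (Fin 5) ℝ) * embedSO3 (rotZ s) * (embedSO3 (rotX (u 2)) * embedSO3 (rotZ (u 1)))) i j)
        (((1 : Matrix (Fin 5) (Fin 5) ℝ) * embedSO3 (rotZ (u 3)) * (embedSO3 (rotX (u 2)) * embedSO3 (rotZ (u 1))) *
          infRot (eulerVelocity u 2)) i j) (u 3) := fun i j => by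
      refine (hasDerivAt_const_mul_mul (hasDerivAt_rotZ (u 3)) _ _ i j).congr_deriv ?_
      have : eulerVelocity u 2 = ![Real.cos (u 1) * ![0, Real.sin (u 2), Real.cos (u 2)] 0 +
          Real.sin (u 1) * (![0, Real.sin (u 2), Real.cos (u 2)] : Fin 3 → ℝ) 1,
          -Real.sin (u 1) * ![0, Real.sin (u 2), Real.cos (u 2)] 0 + Real.cos (u 1) *
          (![0, Real.sin (u 2), Real.cos (u 2)] : Fin 3 → ℝ) 1,
          (![0, Real.sin (u 2), Real.cos (u 2)] : Fin 3 → ℝ) 2] := by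
        ext i; fin_cases i <;> simp [eulerVelocity] <;> ring
      rw [this]
      simp only [Matrix.mul_assoc]
      rw [← infRot_mul_rotZ, ← Matrix.mul_assoc (infRot _) (embedSO3 (rotX (u 2))),
        infRot_mul_rotX]
      simp only [Matrix.mul_assoc]
    have h2 := hasDerivAt_bundleAct h (slicePoint (curve lam ε η (u 0)))
    simp only [Matrix.one_mul, ← embedSO3_mul, ← Matrix.mul_assoc] at h2
    exact h2

/-- By invariance the value is that at the slice point. There a increases strictly and x₁ does not
decrease, so the derivative of (x₁ a)² is positive even when x₁ is constant. -/
lemma starPhi_sheet_pos (hlam : 0 < lam) {u : Fin 4 → ℝ} (hu : u ∈ eulerBox) :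
    0 < starPhi lam (sheet lam ε η u) (coordTangent (sheet lam ε η) u) := by
  have h0 : 0 < u 0 := hu.1
  have hc := isSlice_curve (ε := ε) (η := η) hlam h0
  rw [coordTangent_sheet hlam h0, sheet, orbitMap,
    starPhi_act lam (euler_mem u) _ _ hc.nonpole,
    starPhi_slice hlam hc (curve_mul_curveDeriv hlam h0) (curveDeriv_proj hlam h0),
    det_eulerVelocity]
  have a0 := curve_zero_pos (ε := ε) (η := η) hlam h0
  have a1 := curve_one_pos (ε := ε) (η := η) hlam h0
  have b0 := curveDeriv_zero_pos (ε := ε) (η := η) hlam h0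
  have b1 := curveDeriv_one_nonneg (lam := lam) (ε := ε) (η := η) h0
  have hs := Real.sin_pos_of_pos_of_lt_pi hu.2.2.1.1 hu.2.2.1.2
  positivity

end

/-! ### Euler angles cover the rotations, and sheets are injective -/

lemma exists_polar (a b : ℝ) : ∃ r θ, 0 ≤ r ∧ 0 ≤ θ ∧ θ < 2 * Real.pi ∧
    a = r * Real.cos θ ∧ b = r * Real.sin θ := by
  have h1 := Complex.norm_mul_cos_arg ⟨a, b⟩
  have h2 := Complex.norm_mul_sin_arg ⟨a, b⟩
  have h3 := Complex.neg_pi_lt_arg ⟨a, b⟩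
  have h4 := Complex.arg_le_pi ⟨a, b⟩
  have hpi := Real.pi_pos
  rcases le_or_gt 0 (Complex.arg ⟨a, b⟩) with h | h
  · exact ⟨‖(⟨a, b⟩ : ℂ)‖, _, norm_nonneg _, h, by linarith, h1.symm, h2.symm⟩
  · refine ⟨‖(⟨a, b⟩ : ℂ)‖, Complex.arg ⟨a, b⟩ + 2 * Real.pi, norm_nonneg _, by linarith, by linarith, ?_, ?_⟩
    · rw [Real.cos_add_two_pi]; exact h1.symm
    · rw [Real.sin_add_two_pi]; exact h2.symm

lemma exists_rotZ {k : Matrix (Fin 3) (Fin 3) ℝ} (hk : k ∈ specialOrthogonalGroup (Fin 3) ℝ)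
    (h : k 2 2 = 1) : ∃ θ, 0 ≤ θ ∧ θ < 2 * Real.pi ∧ k = rotZ θ := by
  obtain ⟨⟨h00, h01, h02⟩, ⟨h10, h11, h12⟩, h20, h21, h22⟩ := cofactor_of_mem_SO3 hk
  have r := rows_of_mem_SO3 hk 2 2
  have c := columns_of_mem_SO3 hk 2 2
  have c0 := columns_of_mem_SO3 hk 0 0
  simp only [if_true, h] at r c c0
  have k20 : k 2 0 = 0 := mul_self_eq_zero.1
    (le_antisymm (by linarith [mul_self_nonneg (k 2 1)]) (mul_self_nonneg _))
  have k21 : k 2 1 = 0 := mul_self_eq_zero.1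
    (le_antisymm (by linarith [mul_self_nonneg (k 2 0)]) (mul_self_nonneg _))
  have k02 : k 0 2 = 0 := mul_self_eq_zero.1
    (le_antisymm (by linarith [mul_self_nonneg (k 1 2)]) (mul_self_nonneg _))
  have k12 : k 1 2 = 0 := mul_self_eq_zero.1
    (le_antisymm (by linarith [mul_self_nonneg (k 0 2)]) (mul_self_nonneg _))
  rw [h, k20, k02] at h11
  rw [h, k21, k02] at h10
  rw [k20] at c0
  obtain ⟨r, θ, hr, hθ, hθ', ha, hb⟩ := exists_polar (k 0 0) (k 1 0)
  have hr1 : r = 1 := by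
    have := Real.sin_sq_add_cos_sq θ
    rw [ha, hb] at c0
    exact (sq_eq_sq₀ hr zero_le_one).1 (by linear_combination c0 - r ^ 2 * this)
  refine ⟨θ, hθ, hθ', ?_⟩
  rw [hr1, one_mul] at ha hb
  ext i j
  fin_cases i <;> fin_cases j <;> simp [rotZ] <;> linarith

/-- The third column of g has the form (sin α sin β, -cos α sin β, cos β), which determines α and β.
Removing these two rotations leaves one that fixes the third axis. -/
lemma exists_euler {g : Matrix (Fin 3) (Fin 3) ℝ} (hg : g ∈ specialOrthogonalGroup (Fin 3) ℝ)
    (t : ℝ) : ∃ u : Fin 4 → ℝ, u 0 = t ∧ (0 ≤ u 1 ∧ u 1 < 2 * Real.pi) ∧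
      (0 ≤ u 2 ∧ u 2 ≤ Real.pi) ∧ (0 ≤ u 3 ∧ u 3 < 2 * Real.pi) ∧ g = euler u := by
  obtain ⟨r, α, hr, hα, hα', ha, hb⟩ := exists_polar (-g 1 2) (g 0 2)
  have c := columns_of_mem_SO3 hg 2 2
  simp only [if_true] at c
  have hr2 : r ^ 2 = 1 - g 2 2 ^ 2 := by
    have h := Real.sin_sq_add_cos_sq α
    have h1 : r ^ 2 = (-g 1 2) ^ 2 + g 0 2 ^ 2 := by
      rw [ha, hb]
      linear_combination -r ^ 2 * h
    linear_combination h1 + c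
  have hcos : Real.cos (Real.arccos (g 2 2)) = g 2 2 :=
    Real.cos_arccos (by nlinarith) (by nlinarith)
  have hsin : Real.sin (Real.arccos (g 2 2)) = r := by
    rw [Real.sin_arccos, ← hr2, Real.sqrt_sq hr]
  have hR := mul_mem (rotZ_mem α) (rotX_mem (Real.arccos (g 2 2)))
  have hR1 := mem_specialOrthogonalGroup_iff.1 hR
  have hRT : (rotZ α * rotX (Real.arccos (g 2 2)))ᵀ ∈ specialOrthogonalGroup (Fin 3) ℝ := by
    refine mem_specialOrthogonalGroup_iff.2 ⟨(mem_orthogonalGroup_iff _ _).2 ?_, ?_⟩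
    · rw [transpose_transpose]
      exact (mem_orthogonalGroup_iff' _ _).1 hR1.1
    · rw [det_transpose, hR1.2]
  obtain ⟨γ, hγ, hγ', hk⟩ := exists_rotZ (mul_mem hRT hg) (by
    simp only [mul_apply, transpose_apply, Fin.sum_univ_three, rotZ, rotX]
    simp [hcos, hsin]
    linear_combination (-1 : ℝ) * (g 0 2) * hb - (-g 1 2) * ha + c)
  refine ⟨![t, γ, Real.arccos (g 2 2), α], rfl, ⟨hγ, hγ'⟩,
    ⟨Real.arccos_nonneg _, Real.arccos_le_pi _⟩, ⟨hα, hα'⟩, ?_⟩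
  change g = rotZ α * rotX (Real.arccos (g 2 2)) * rotZ γ
  rw [← hk, ← Matrix.mul_assoc, (mem_orthogonalGroup_iff _ _).1 hR1.1, Matrix.one_mul]

lemma eq_of_cos_eq_of_sin_eq {a b : ℝ} (ha : 0 < a) (ha' : a < 2 * Real.pi) (hb : 0 < b)
    (hb' : b < 2 * Real.pi) (hc : Real.cos a = Real.cos b) (hs : Real.sin a = Real.sin b) :
    a = b := by
  have h : Real.cos (a - b) = 1 := by
    rw [Real.cos_sub, hc, hs]
    linear_combination Real.sin_sq_add_cos_sq b
  have := (Real.cos_eq_one_iff_of_lt_of_lt (by linarith) (by linarith)).1 h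
  linarith

lemma euler_injOn {u v : Fin 4 → ℝ} (hu : u ∈ eulerBox) (hv : v ∈ eulerBox)
    (h : euler u = euler v) (h0 : u 0 = v 0) : u = v := by
  obtain ⟨-, ⟨u1, u1'⟩, ⟨u2, u2'⟩, u3, u3'⟩ := hu
  obtain ⟨-, ⟨v1, v1'⟩, ⟨v2, v2'⟩, v3, v3'⟩ := hv
  rw [euler_eq, euler_eq] at h
  have e : ∀ i j, _ := fun i j => congrFun (congrFun h i) j
  have e22 : Real.cos (u 2) = Real.cos (v 2) := e 2 2
  have h2 : u 2 = v 2 := Real.injOn_cos ⟨u2.le, u2'.le⟩ ⟨v2.le, v2'.le⟩ e22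
  have hs := (Real.sin_pos_of_pos_of_lt_pi v2 v2').ne'
  have e20 : Real.sin (u 2) * Real.sin (u 1) = Real.sin (v 2) * Real.sin (v 1) := e 2 0
  have e21 : Real.sin (u 2) * Real.cos (u 1) = Real.sin (v 2) * Real.cos (v 1) := e 2 1
  have e02 : Real.sin (u 3) * Real.sin (u 2) = Real.sin (v 3) * Real.sin (v 2) := e 0 2
  have e12 : -(Real.cos (u 3) * Real.sin (u 2)) = -(Real.cos (v 3) * Real.sin (v 2)) := e 1 2
  rw [h2] at e20 e21 e02 e12
  have h1 : u 1 = v 1 := eq_of_cos_eq_of_sin_eq u1 u1' v1 v1' (mul_left_cancel₀ hs e21)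
    (mul_left_cancel₀ hs e20)
  have h3 : u 3 = v 3 := eq_of_cos_eq_of_sin_eq u3 u3' v3 v3'
    (mul_right_cancel₀ hs (neg_injective e12)) (mul_right_cancel₀ hs e02)
  ext i
  fin_cases i
  exacts [h0, h1, h2, h3]

lemma sum_sq_slicePoint {c : Fin 5 → ℝ} (hc : IsSlice c) :
    ∑ k, ∑ l, (slicePoint c).2 k l ^ 2 = 4 * c 0 ^ 2 := by
  have h1 := hc.sphere
  have h2 := hc.proj
  simp [slicePoint, Fin.sum_univ_five]
  grind

lemma bundleAct_embedSO3_fst (g : Matrix (Fin 3) (Fin 3) ℝ) (p : Amb) :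
    (bundleAct (embedSO3 g) p).1 3 = p.1 3 ∧ (bundleAct (embedSO3 g) p).1 4 = p.1 4 := by
  simp [bundleAct, embedSO3, dotProduct, Fin.sum_univ_five]

/-- The action is free here: the base point gives the first column of g, and the fourth and fifth
columns of the 2-form give two combinations of the other columns of g, whose coefficient determinant
is x₁ up to powers of a. -/
lemma eq_of_bundleAct_slicePoint_eq {c : Fin 5 → ℝ} (h0 : c 0 ≠ 0) (h1 : c 1 ≠ 0)
    {g k : Matrix (Fin 3) (Fin 3) ℝ}
    (h : bundleAct (embedSO3 g) (slicePoint c) = bundleAct (embedSO3 k) (slicePoint c)) :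
    g = k := by
  have hx := congrArg Prod.fst h
  have hA := congrArg Prod.snd h
  have e1 : ∀ (g : Matrix (Fin 3) (Fin 3) ℝ) (i : Fin 3),
      (bundleAct (embedSO3 g) (slicePoint c)).1 (Fin.castLE (by norm_num) i) = g i 0 * c 1 := by
    intro g i
    fin_cases i <;>
      simp [bundleAct, embedSO3, slicePoint, Fin.sum_univ_five] <;> ring
  have e2 : ∀ (g : Matrix (Fin 3) (Fin 3) ℝ) (i : Fin 3),
      (bundleAct (embedSO3 g) (slicePoint c)).2 (Fin.castLE (by norm_num) i) 3 =
        c 0 * (g i 1 * (1 - c 2 * c 4) - g i 2 * (c 1 * c 4)) := by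
    intro g i
    fin_cases i <;>
      simp [bundleAct, embedSO3, slicePoint, Fin.sum_univ_five] <;> ring
  have e3 : ∀ (g : Matrix (Fin 3) (Fin 3) ℝ) (i : Fin 3),
      (bundleAct (embedSO3 g) (slicePoint c)).2 (Fin.castLE (by norm_num) i) 4 =
        c 0 * (g i 1 * c 2 + g i 2 * c 1) := by
    intro g i
    fin_cases i <;>
      simp [bundleAct, embedSO3, slicePoint, Fin.sum_univ_five] <;> ring
  ext i j
  have a1 := (e1 g i).symm.trans ((congrFun hx _).trans (e1 k i))
  have a2 := (e2 g i).symm.trans ((congrFun (congrFun hA _) _).trans (e2 k i))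
  have a3 := (e3 g i).symm.trans ((congrFun (congrFun hA _) _).trans (e3 k i))
  have h01 := mul_ne_zero h0 h1
  fin_cases j
  · exact mul_right_cancel₀ h1 a1
  · refine mul_left_cancel₀ h01 ?_
    change c 0 * c 1 * g i 1 = c 0 * c 1 * k i 1
    linear_combination c 1 * a2 + c 1 * c 4 * a3
  · refine mul_left_cancel₀ h01 ?_
    change c 0 * c 1 * g i 2 = c 0 * c 1 * k i 2
    linear_combination -c 2 * a2 + (1 - c 2 * c 4) * a3

/-- Distinct parameters give distinct points, also across different sheets. -/
lemma sheet_injective {lam ε η ε' η' : ℝ} (hlam : 0 < lam) {u v : Fin 4 → ℝ}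
    (hu : u ∈ eulerBox) (hv : v ∈ eulerBox) (h : sheet lam ε η u = sheet lam ε' η' v) :
    ε = ε' ∧ η = η' ∧ u = v := by
  have hz := radius_pos (ε := ε) (η := η) (t := u 0) hlam
  have hz' := radius_pos (ε := ε') (η := η') (t := v 0) hlam
  have hr : radius lam ε η (u 0) = radius lam ε' η' (v 0) := by
    have e := congrArg (fun p : Amb => ∑ k, ∑ l, p.2 k l ^ 2) h
    simp only [sheet, orbitMap, sum_sq_act (euler_mem _),
      sum_sq_slicePoint (isSlice_curve hlam hu.1), sum_sq_slicePoint (isSlice_curve hlam hv.1),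
      curve_zero_sq hlam hu.1, curve_zero_sq hlam hv.1] at e
    have e' : radius lam ε η (u 0) ^ 2 = radius lam ε' η' (v 0) ^ 2 := by linarith
    rwa [sq_eq_sq₀ hz.le hz'.le] at e'
  have hy : (√(radius lam ε' η' (v 0)))⁻¹ ≠ 0 := inv_ne_zero (Real.sqrt_pos.2 hz').ne'
  have h4 : ε * (√(radius lam ε η (u 0)))⁻¹ = ε' * (√(radius lam ε' η' (v 0)))⁻¹ := by
    have e := congrArg (fun p : Amb => p.1 3) h
    simp only [sheet, orbitMap, (bundleAct_embedSO3_fst _ _).1] at e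
    exact e
  have h5 : η * (√(radius lam ε η (u 0)))⁻¹ = η' * (√(radius lam ε' η' (v 0)))⁻¹ := by
    have e := congrArg (fun p : Amb => p.1 4) h
    simp only [sheet, orbitMap, (bundleAct_embedSO3_fst _ _).2] at e
    exact e
  rw [hr] at h4 h5
  obtain rfl := mul_right_cancel₀ hy h4
  obtain rfl := mul_right_cancel₀ hy h5
  have ht : u 0 = v 0 := by
    have e : u 0 ^ 2 = v 0 ^ 2 := by
      unfold radius at hr
      linarith
    rwa [sq_eq_sq₀ hu.1.le hv.1.le] at e
  refine ⟨rfl, rfl, euler_injOn hu hv ?_ ht⟩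
  unfold sheet orbitMap at h
  simp only [ht] at h
  exact eq_of_bundleAct_slicePoint_eq (curve_zero_pos hlam hv.1).ne' (curve_one_pos hlam hv.1).ne' h

lemma sheet_mem_M {lam ε η : ℝ} (hlam : 0 < lam) {u : Fin 4 → ℝ} (hu : 0 < u 0) :
    sheet lam ε η u ∈ M lam (ε ^ 4) (η ^ 4) 0 := by
  have hz := (radius_pos (ε := ε) (η := η) (t := u 0) hlam).ne'
  have hc := isSlice_curve (ε := ε) (η := η) hlam hu
  have h0 := curve_zero_sq (ε := ε) (η := η) hlam hu
  have hy := inv_sqrt_radius_sq (ε := ε) (η := η) (t := u 0) hlam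
  have key : ∀ s, (s * (√(radius lam ε η (u 0)))⁻¹) ^ 4 *
      (lam + (0 ^ 2 + curve lam ε η (u 0) 0 ^ 2)) = s ^ 4 := fun s => by
    rw [h0]
    calc _ = s ^ 4 * ((√(radius lam ε η (u 0)))⁻¹ ^ 2) ^ 2 * radius lam ε η (u 0) ^ 2 := by ring
      _ = _ := by rw [hy]; field_simp
  refine ⟨euler u, euler_mem u, curve lam ε η (u 0) 1, curve lam ε η (u 0) 2,
    curve lam ε η (u 0) 3, 0, curve lam ε η (u 0) 0, hc.sphere, key ε, key η, zero_mul _, ?_⟩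
  rw [bundlePoint_slice hc]
  rfl

/-! ### Null sets: seams of the Euler angles, zero section, fixed circle -/

/-- A C¹ map on a convex set does not raise Hausdorff dimension, and a coordinate hyperplane has
dimension at most 3. -/
lemma hausdorffMeasure_image_eq_zero {f : (Fin 4 → ℝ) → Amb} {s : Set (Fin 4 → ℝ)}
    (hf : ContDiffOn ℝ 1 f s) (hs : Convex ℝ s) (i : Fin 4) (x : ℝ) :
    Measure.hausdorffMeasure 4 (f '' (s ∩ {u | u i = x})) = 0 := by
  have h1 : dimH {u : Fin 4 → ℝ | u i = x} ≤ 3 := by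
    have e : {u : Fin 4 → ℝ | u i = x} ⊆ Set.range (fun v : Fin 3 → ℝ => i.insertNth x v) := by
      intro u hu
      exact ⟨i.removeNth u, by rw [← hu]; exact Fin.insertNth_self_removeNth i u⟩
    have hc : ContDiff ℝ 1 (fun v : Fin 3 → ℝ => (i.insertNth x v : Fin 4 → ℝ)) := by
      rw [contDiff_pi]
      intro j
      refine Fin.succAboveCases i ?_ (fun k => ?_) j
      · simpa using contDiff_const
      · simpa using contDiff_apply ℝ ℝ k
    have h := (dimH_mono e).trans hc.dimH_range_le
    simpa using h
  have h2 : dimH (f '' (s ∩ {u | u i = x})) ≤ 3 :=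
    (hf.dimH_image_le hs Set.inter_subset_left).trans ((dimH_mono Set.inter_subset_right).trans h1)
  have h3 := hausdorffMeasure_of_dimH_lt (d := 4) (lt_of_le_of_lt h2 (by norm_num))
  simpa using h3

lemma hausdorffMeasure_range_eq_zero {f : (Fin 3 → ℝ) → Amb} (hf : ContDiff ℝ 1 f) :
    Measure.hausdorffMeasure 4 (Set.range f) = 0 := by
  have h2 : dimH (Set.range f) ≤ 3 := by simpa using hf.dimH_range_le
  have h3 := hausdorffMeasure_of_dimH_lt (d := 4) (lt_of_le_of_lt h2 (by norm_num))
  simpa using h3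

/-- The points over `(v, x₄, x₅)` in the zero section. -/
def zeroPoint (x₄ x₅ : ℝ) (v : Fin 3 → ℝ) : Amb := (![v 0, v 1, v 2, x₄, x₅], 0)

/-- The points over `(0, 0, 0, x₄, x₅)` with `2`-form `v ∧ (n₄, n₅) + s * v`. -/
def axisPoint (x₄ x₅ n₄ n₅ s : ℝ) (v : Fin 3 → ℝ) : Amb :=
  (![0, 0, 0, x₄, x₅],
    ![![0, s * v 2, -(s * v 1), v 0 * n₄, v 0 * n₅],
      ![-(s * v 2), 0, s * v 0, v 1 * n₄, v 1 * n₅],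
      ![s * v 1, -(s * v 0), 0, v 2 * n₄, v 2 * n₅],
      ![-(v 0 * n₄), -(v 1 * n₄), -(v 2 * n₄), 0, 0],
      ![-(v 0 * n₅), -(v 1 * n₅), -(v 2 * n₅), 0, 0]])

lemma contDiff_zeroPoint (x₄ x₅ : ℝ) : ContDiff ℝ 1 (zeroPoint x₄ x₅) := by
  refine ContDiff.prodMk (contDiff_pi.2 fun i => ?_) contDiff_const
  fin_cases i <;> simp <;> fun_prop

lemma contDiff_axisPoint (x₄ x₅ n₄ n₅ s : ℝ) : ContDiff ℝ 1 (axisPoint x₄ x₅ n₄ n₅ s) := by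
  refine ContDiff.prodMk (contDiff_pi.2 fun i => ?_)
    (contDiff_pi.2 fun i => contDiff_pi.2 fun j => ?_)
  · fin_cases i <;> simp <;> fun_prop
  · fin_cases i <;> fin_cases j <;> simp <;> fun_prop

lemma bundleAct_zeroSection (g : Matrix (Fin 3) (Fin 3) ℝ) (x₁ x₄ x₅ : ℝ) :
    bundleAct (embedSO3 g) (bundlePoint ![x₁, 0, 0, x₄, x₅] ![0, 0, 0]) =
      zeroPoint x₄ x₅ ![g 0 0 * x₁, g 1 0 * x₁, g 2 0 * x₁] := by
  refine Prod.ext ?_ ?_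
  · ext i
    fin_cases i <;>
      simp [bundleAct, embedSO3, bundlePoint, zeroPoint, Fin.sum_univ_five] <;>
      ring
  · ext i j
    simp [bundleAct, bundlePoint, zeroPoint, Fin.sum_univ_three]

/-- The Hodge star of ℝ³ commutes with rotations. Orbits over the fixed circle thus stay in the
range of one map from ℝ³. -/
lemma bundleAct_axisPoint {g : Matrix (Fin 3) (Fin 3) ℝ}
    (hg : g ∈ specialOrthogonalGroup (Fin 3) ℝ) (x₄ x₅ n₄ n₅ s : ℝ) (v : Fin 3 → ℝ) :
    bundleAct (embedSO3 g) (axisPoint x₄ x₅ n₄ n₅ s v) = axisPoint x₄ x₅ n₄ n₅ s (g *ᵥ v) := by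
  obtain ⟨⟨h00, h01, h02⟩, ⟨h10, h11, h12⟩, h20, h21, h22⟩ := cofactor_of_mem_SO3 hg
  refine Prod.ext ?_ ?_
  · ext i
    fin_cases i <;>
      simp [bundleAct, embedSO3, axisPoint, mulVec, dotProduct, Fin.sum_univ_five]
  · ext i j
    fin_cases i <;> fin_cases j <;>
      simp [bundleAct, embedSO3, axisPoint, mulVec, dotProduct, Fin.sum_univ_five,
        Fin.sum_univ_three] <;> try ring1
    · linear_combination (-s * v 0) * h20 + (-s * v 1) * h21 + (-s * v 2) * h22
    · linear_combination (s * v 0) * h10 + (s * v 1) * h11 + (s * v 2) * h12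
    · linear_combination (s * v 0) * h20 + (s * v 1) * h21 + (s * v 2) * h22
    · linear_combination (-s * v 0) * h00 + (-s * v 1) * h01 + (-s * v 2) * h02
    · linear_combination (-s * v 0) * h10 + (-s * v 1) * h11 + (-s * v 2) * h12
    · linear_combination (s * v 0) * h00 + (s * v 1) * h01 + (s * v 2) * h02

/-- Over the circle fixed by `SO(3)` the fibres are spanned by axis points. -/
lemma bundlePoint_axis {x₄ x₅ : ℝ} (h : x₄ ^ 2 + x₅ ^ 2 = 1) (a₁ a₂ : ℝ) :
    bundlePoint ![0, 0, 0, x₄, x₅] ![a₁, a₂, 0] =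
      if x₄ = 0 then axisPoint x₄ x₅ x₅ 0 (-1) ![0, a₂, -a₁]
      else axisPoint x₄ x₅ (-x₅) x₄ 1 ![a₁, a₂, 0] := by
  -- On the fixed circle, x₄ = 0 singles out the two poles, where the frame is defined separately.
  split_ifs with h4
  · have h5 : (![0, 0, 0, x₄, x₅] : Fin 5 → ℝ) 4 ^ 2 = 1 := by
      change x₅ ^ 2 = 1
      rw [← h, h4]
      ring
    refine Prod.ext rfl ?_
    ext k l
    rw [bundlePoint, asdFrame, frame, if_pos h5]
    fin_cases k <;> fin_cases l <;>
      simp [axisPoint, wedgeMat, Fin.sum_univ_three, h4]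
  · have h6 : 0 < x₄ ^ 2 := by positivity
    have h5 : 1 - x₅ ≠ 0 := fun e => by
      have : x₅ = 1 := by linarith
      rw [this] at h
      linarith
    have hc : IsSlice ![0, 0, x₄, x₅, x₄ / (1 - x₅)] :=
      { sphere := by simp; linarith
        proj := by simp; field_simp
        nonpole := fun e => by
          have e' : x₅ ^ 2 = 1 := e
          linarith }
    have ha := asdFrame_slice hc
    simp only [cons_val] at ha
    have e1 : x₄ * (x₄ / (1 - x₅)) = 1 + x₅ := by
      field_simp
      linear_combination h
    rw [bundlePoint, ha, Fin.sum_univ_three]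
    refine Prod.ext rfl ?_
    ext k l
    fin_cases k <;> fin_cases l <;> simp [axisPoint, e1]

lemma slicePoint_neg_zero (c : Fin 5 → ℝ) :
    slicePoint ![-c 0, c 1, c 2, c 3, c 4] =
      bundleAct (embedSO3 !![1, 0, 0; 0, -1, 0; 0, 0, -1]) (slicePoint c) := by
  refine Prod.ext ?_ ?_
  · ext i
    fin_cases i <;>
      simp [bundleAct, embedSO3, slicePoint, Fin.sum_univ_five]
  · ext i j
    fin_cases i <;> fin_cases j <;>
      simp [bundleAct, embedSO3, slicePoint, Fin.sum_univ_five]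

lemma slicePoint_neg_one (c : Fin 5 → ℝ) :
    slicePoint ![c 0, -c 1, c 2, c 3, c 4] =
      bundleAct (embedSO3 !![-1, 0, 0; 0, 1, 0; 0, 0, -1]) (slicePoint c) := by
  refine Prod.ext ?_ ?_
  · ext i
    fin_cases i <;>
      simp [bundleAct, embedSO3, slicePoint, Fin.sum_univ_five]
  · ext i j
    fin_cases i <;> fin_cases j <;>
      simp [bundleAct, embedSO3, slicePoint, Fin.sum_univ_five]

lemma diag_mem_SO3 {a b c : ℝ} (ha : a ^ 2 = 1) (hb : b ^ 2 = 1) (hc : c ^ 2 = 1)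
    (h : a * b * c = 1) :
    !![a, 0, 0; 0, b, 0; 0, 0, c] ∈ specialOrthogonalGroup (Fin 3) ℝ := by
  refine mem_specialOrthogonalGroup_iff.2 ⟨(mem_orthogonalGroup_iff _ _).2 ?_, ?_⟩
  · ext i j
    fin_cases i <;> fin_cases j <;> simp [mul_apply, Fin.sum_univ_three] <;> linarith
  · simp [det_fin_three]
    linarith

/-- The signs of `a` and `x₁` can be normalized by the action of `SO(3)`. -/
lemma exists_slicePoint_abs (c : Fin 5 → ℝ) : ∃ k ∈ specialOrthogonalGroup (Fin 3) ℝ,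
    slicePoint c = bundleAct (embedSO3 k) (slicePoint ![|c 0|, |c 1|, c 2, c 3, c 4]) := by
  have m0 := diag_mem_SO3 (a := 1) (b := -1) (c := -1) (by norm_num) (by norm_num) (by norm_num)
    (by norm_num)
  have m1 := diag_mem_SO3 (a := -1) (b := 1) (c := -1) (by norm_num) (by norm_num) (by norm_num)
    (by norm_num)
  have h0 : ∀ c : Fin 5 → ℝ, ∃ k ∈ specialOrthogonalGroup (Fin 3) ℝ,
      slicePoint c = bundleAct (embedSO3 k) (slicePoint ![|c 0|, c 1, c 2, c 3, c 4]) := by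
    intro c
    rcases abs_cases (c 0) with ⟨e, -⟩ | ⟨e, -⟩
    · refine ⟨1, one_mem _, ?_⟩
      rw [e, embedSO3_one, bundleAct_eq]
      simp [slicePoint]
      rfl
    · refine ⟨_, m0, ?_⟩
      rw [e, ← slicePoint_neg_zero]
      simp [slicePoint]
  have h1 : ∀ c : Fin 5 → ℝ, ∃ k ∈ specialOrthogonalGroup (Fin 3) ℝ,
      slicePoint c = bundleAct (embedSO3 k) (slicePoint ![c 0, |c 1|, c 2, c 3, c 4]) := by
    intro c
    rcases abs_cases (c 1) with ⟨e, -⟩ | ⟨e, -⟩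
    · refine ⟨1, one_mem _, ?_⟩
      rw [e, embedSO3_one, bundleAct_eq]
      simp [slicePoint]
      rfl
    · refine ⟨_, m1, ?_⟩
      rw [e, ← slicePoint_neg_one]
      simp [slicePoint]
  obtain ⟨k, hk, e⟩ := h0 c
  obtain ⟨l, hl, e'⟩ := h1 ![|c 0|, c 1, c 2, c 3, c 4]
  refine ⟨k * l, mul_mem hk hl, ?_⟩
  rw [embedSO3_mul, bundleAct_mul, e, e']
  rfl

/-- The singular points of `M_{C,D,0}` with `C = ε ^ 4`, `D = η ^ 4`, and the points of the zero
section. -/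
def degeneratePart (lam ε η : ℝ) : Set Amb :=
  Set.range (zeroPoint (ε * (√√lam)⁻¹) (η * (√√lam)⁻¹)) ∪
    (Set.range (axisPoint (ε * (√(ε ^ 2 + η ^ 2))⁻¹) (η * (√(ε ^ 2 + η ^ 2))⁻¹)
        (η * (√(ε ^ 2 + η ^ 2))⁻¹) 0 (-1)) ∪
      Set.range (axisPoint (ε * (√(ε ^ 2 + η ^ 2))⁻¹) (η * (√(ε ^ 2 + η ^ 2))⁻¹)
        (-(η * (√(ε ^ 2 + η ^ 2))⁻¹)) (ε * (√(ε ^ 2 + η ^ 2))⁻¹) 1))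

/-- The points of a sheet at which the Euler angles degenerate. -/
def seam (lam ε η : ℝ) : Set Amb :=
  sheet lam ε η '' ({u | 0 < u 0} ∩ {u | u 1 = 0}) ∪
    sheet lam ε η '' ({u | 0 < u 0} ∩ {u | u 2 = 0}) ∪
    sheet lam ε η '' ({u | 0 < u 0} ∩ {u | u 2 = Real.pi}) ∪
    sheet lam ε η '' ({u | 0 < u 0} ∩ {u | u 3 = 0})

lemma hausdorffMeasure_degeneratePart (lam ε η : ℝ) :
    Measure.hausdorffMeasure 4 (degeneratePart lam ε η) = 0 :=
  measure_union_null (hausdorffMeasure_range_eq_zero (contDiff_zeroPoint _ _))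
    (measure_union_null (hausdorffMeasure_range_eq_zero (contDiff_axisPoint _ _ _ _ _))
      (hausdorffMeasure_range_eq_zero (contDiff_axisPoint _ _ _ _ _)))

lemma hausdorffMeasure_seam {lam : ℝ} (hlam : 0 < lam) (ε η : ℝ) :
    Measure.hausdorffMeasure 4 (seam lam ε η) = 0 := by
  have hf : ContDiffOn ℝ 1 (sheet lam ε η) {u | 0 < u 0} :=
    (contDiffOn_sheet hlam).of_le (by norm_cast)
  have hs : Convex ℝ {u : Fin 4 → ℝ | 0 < u 0} :=
    convex_halfSpace_gt (LinearMap.proj (R := ℝ) (φ := fun _ : Fin 4 => ℝ) 0).isLinear 0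
  exact measure_union_null (measure_union_null (measure_union_null
    (hausdorffMeasure_image_eq_zero hf hs _ _) (hausdorffMeasure_image_eq_zero hf hs _ _))
    (hausdorffMeasure_image_eq_zero hf hs _ _)) (hausdorffMeasure_image_eq_zero hf hs _ _)

/-! ### Covering the set by sheets -/

lemma mem_sheet_or_seam {lam ε η t : ℝ} (ht : 0 < t) {g : Matrix (Fin 3) (Fin 3) ℝ}
    (hg : g ∈ specialOrthogonalGroup (Fin 3) ℝ) :
    bundleAct (embedSO3 g) (slicePoint (curve lam ε η t)) ∈
      sheet lam ε η '' eulerBox ∪ seam lam ε η := by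
  obtain ⟨u, h0, ⟨h1, h1'⟩, ⟨h2, h2'⟩, ⟨h3, h3'⟩, rfl⟩ := exists_euler hg t
  have e : bundleAct (embedSO3 (euler u)) (slicePoint (curve lam ε η t)) = sheet lam ε η u := by
    rw [sheet, orbitMap, h0]
  rw [e]
  have h0' : 0 < u 0 := by rwa [h0]
  rcases h1.eq_or_lt with h1 | h1
  · exact Or.inr (Or.inl (Or.inl (Or.inl ⟨u, ⟨h0', h1.symm⟩, rfl⟩)))
  rcases h2.eq_or_lt with h2 | h2
  · exact Or.inr (Or.inl (Or.inl (Or.inr ⟨u, ⟨h0', h2.symm⟩, rfl⟩)))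
  rcases h2'.eq_or_lt with h2' | h2'
  · exact Or.inr (Or.inl (Or.inr ⟨u, ⟨h0', h2'⟩, rfl⟩))
  rcases h3.eq_or_lt with h3 | h3
  · exact Or.inr (Or.inr ⟨u, ⟨h0', h3.symm⟩, rfl⟩)
  exact Or.inl ⟨u, ⟨h0', ⟨h1, h1'⟩, ⟨h2, h2'⟩, h3, h3'⟩, rfl⟩

/-- The set `M_{C,D,0}` is covered by the sheets with `ε ^ 4 = C`, `η ^ 4 = D`. -/
lemma exists_sheet_of_mem_M {lam C D : ℝ} (hlam : 0 < lam) {q : Amb} (hq : q ∈ M lam C D 0) :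
    ∃ ε η, ε ^ 4 = C ∧ η ^ 4 = D ∧
      q ∈ sheet lam ε η '' eulerBox ∪ (seam lam ε η ∪ degeneratePart lam ε η) := by
  obtain ⟨g, hg, x₁, x₄, x₅, a₁, a₂, hx, hC, hD, hE, rfl⟩ := hq
  obtain ⟨z, hz⟩ : ∃ z, z = √(lam + (a₁ ^ 2 + a₂ ^ 2)) := ⟨_, rfl⟩
  have hz0 : 0 < z := by rw [hz]; positivity
  have hz2 : z ^ 2 = lam + (a₁ ^ 2 + a₂ ^ 2) := by rw [hz]; exact Real.sq_sqrt (by positivity)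
  have hs : √z ^ 2 = z := Real.sq_sqrt hz0.le
  have hs0 : √z ≠ 0 := (Real.sqrt_pos.2 hz0).ne'
  -- The roots are read off from x₄ = ε z^{-1/2} and x₅ = η z^{-1/2}.
  refine ⟨x₄ * √z, x₅ * √z, ?_, ?_, ?_⟩
  · rw [← hC, ← hz2, mul_pow]
    congr 1
    calc √z ^ 4 = (√z ^ 2) ^ 2 := by ring
      _ = z ^ 2 := by rw [hs]
  · rw [← hD, ← hz2, mul_pow]
    congr 1
    calc √z ^ 4 = (√z ^ 2) ^ 2 := by ring
      _ = z ^ 2 := by rw [hs]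
  have hm : (x₄ * √z) ^ 2 + (x₅ * √z) ^ 2 = (1 - x₁ ^ 2) * z := by
    rw [mul_pow, mul_pow, hs]
    linear_combination z * hx
  have hcancel : ∀ x, x * √z * (√z)⁻¹ = x := fun x => mul_inv_cancel_right₀ hs0 x
  by_cases h1 : x₁ = 0
  -- If x₁ = 0 then z = ε² + η², so x₄ and x₅ are the constants used in `degeneratePart`.
  · refine Or.inr (Or.inr (Or.inr ?_))
    rw [h1] at hm hx ⊢
    rw [hm, sub_eq_self.2 (by norm_num : (0 : ℝ) ^ 2 = 0), one_mul, hcancel, hcancel,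
      bundlePoint_axis (by linarith)]
    split_ifs with h4
    · exact Or.inl ⟨_, (bundleAct_axisPoint hg _ _ _ _ _ _).symm⟩
    · exact Or.inr ⟨_, (bundleAct_axisPoint hg _ _ _ _ _ _).symm⟩
  have ha1 : a₁ = 0 := (mul_eq_zero.1 hE).resolve_right h1
  subst ha1
  by_cases ha2 : a₂ = 0
  · refine Or.inr (Or.inr (Or.inl ?_))
    subst ha2
    have e : √lam = z := by rw [hz]; congr 1; ring
    rw [e, hcancel, hcancel, bundleAct_zeroSection]
    exact ⟨_, rfl⟩
  rw [← Set.union_assoc]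
  refine Or.inl ?_
  have hx1 : 0 < x₁ ^ 2 := by positivity
  have ha : 0 < a₂ ^ 2 := by positivity
  -- Strict in the first entry because a₂ ≠ 0, and in the second because x₁ ≠ 0; the gap is t².
  have hlt : max √lam ((x₄ * √z) ^ 2 + (x₅ * √z) ^ 2) < z := by
    refine max_lt ?_ ?_
    · rw [hz]
      exact Real.sqrt_lt_sqrt hlam.le (by linarith)
    · rw [hm]
      nlinarith
  obtain ⟨t, ht⟩ : ∃ t, t = √(z - max √lam ((x₄ * √z) ^ 2 + (x₅ * √z) ^ 2)) := ⟨_, rfl⟩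
  have ht0 : 0 < t := by rw [ht]; exact Real.sqrt_pos.2 (sub_pos.2 hlt)
  have hrad : radius lam (x₄ * √z) (x₅ * √z) t = z := by
    rw [radius, ht, Real.sq_sqrt (sub_pos.2 hlt).le]
    ring
  have hc5 : x₅ ^ 2 < 1 := by nlinarith [sq_nonneg x₄]
  have hx5 : 0 < 1 - x₅ := sub_pos.2 (lt_of_abs_lt ((sq_lt_one_iff_abs_lt_one _).1 hc5))
  have hcurve : curve lam (x₄ * √z) (x₅ * √z) t =
      ![|a₂|, |x₁|, x₄, x₅, x₄ / (1 - x₅)] := by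
    have e1 : z ^ 2 - lam = a₂ ^ 2 := by rw [hz2]; ring
    have e2 : 1 - (1 - x₁ ^ 2) * z / z = x₁ ^ 2 := by
      rw [mul_div_cancel_right₀ _ hz0.ne']; ring
    simp only [curve, hrad, hcancel, hm, e1, e2, Real.sqrt_sq_eq_abs]
  have hc : IsSlice ![a₂, x₁, x₄, x₅, x₄ / (1 - x₅)] :=
    { sphere := hx
      proj := div_mul_cancel₀ _ hx5.ne'
      nonpole := hc5.ne }
  obtain ⟨k, hk, e⟩ := exists_slicePoint_abs ![a₂, x₁, x₄, x₅, x₄ / (1 - x₅)]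
  have e' : bundlePoint ![x₁, 0, 0, x₄, x₅] ![0, a₂, 0] =
      bundleAct (embedSO3 k) (slicePoint (curve lam (x₄ * √z) (x₅ * √z) t)) := by
    rw [hcurve]
    exact (bundlePoint_slice hc).trans e
  rw [e', ← bundleAct_mul, ← embedSO3_mul]
  exact mem_sheet_or_seam ht0 (mul_mem hg hk)

/-! ### The current of integration as a finite sum over sheets -/

/-- The sheets as positively oriented patches. -/
def sheetPatch {lam : ℝ} (hlam : 0 < lam) (ε η : ℝ) :
    OrientedPatch lam (M lam (ε ^ 4) (η ^ 4) 0) where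
  toFun := sheet lam ε η
  dom := eulerBox
  isOpen_dom := isOpen_eulerBox
  contDiffOn := (contDiffOn_sheet hlam).mono fun _ hu => hu.1
  injOn := fun _ hu _ hv h => (sheet_injective hlam hu hv h).2.2
  mapsTo := fun _ hu => sheet_mem_M hlam hu.1
  pos := fun _ hu => starPhi_sheet_pos hlam hu

/-- The empty patch. -/
def emptyPatch (lam : ℝ) (S : Set Amb) : OrientedPatch lam S where
  toFun := fun _ => 0
  dom := ∅
  isOpen_dom := isOpen_empty
  contDiffOn := contDiffOn_const
  injOn := Set.injOn_empty _
  mapsTo := Set.mapsTo_empty _ _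
  pos := fun _ hu => hu.elim

/-- The integral of a form over a sheet. -/
def sheetIntegral (lam ε η : ℝ) (α : TestForm) : ℝ :=
  ∫ u in eulerBox, pullbackCoeff (sheet lam ε η) α u

/-- The set `M_{C,D,0}` carries the sum of the currents of its sheets. -/
lemma isIntegrationCurrent_M {lam C D : ℝ} (hlam : 0 < lam) (n : ℕ) (e : ℕ → ℝ × ℝ)
    (he : ∀ i < n, (e i).1 ^ 4 = C ∧ (e i).2 ^ 4 = D)
    (hinj : ∀ i < n, ∀ j < n, e i = e j → i = j)
    (hsurj : ∀ ε η, ε ^ 4 = C → η ^ 4 = D → ∃ i < n, e i = (ε, η))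
    (hint : ∀ i < n, ∀ α, IntegrableOn (pullbackCoeff (sheet lam (e i).1 (e i).2) α) eulerBox) :
    IsIntegrationCurrent lam (M lam C D 0)
      fun α => ∑ i ∈ Finset.range n, sheetIntegral lam (e i).1 (e i).2 α := by
  classical
  -- The type of a patch mentions C and D, and they are the fourth powers only after substitution;
  -- so the patch is chosen by its map and domain. Indices from n on receive empty patches.
  have hP : ∀ i, ∃ P : OrientedPatch lam (M lam C D 0),
      if i < n then P.toFun = sheet lam (e i).1 (e i).2 ∧ P.dom = eulerBox else P.dom = ∅ := by
    intro i
    by_cases hi : i < n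
    · obtain ⟨h1, h2⟩ := he i hi
      subst h1 h2
      exact ⟨sheetPatch hlam _ _, by rw [if_pos hi]; exact ⟨rfl, rfl⟩⟩
    · exact ⟨emptyPatch lam _, by rw [if_neg hi]; rfl⟩
  choose P hP using hP
  have hlt : ∀ i, i < n → (P i).toFun = sheet lam (e i).1 (e i).2 ∧ (P i).dom = eulerBox :=
    fun i hi => by simpa [hi] using hP i
  have hge : ∀ i, ¬ i < n → (P i).dom = ∅ := fun i hi => by simpa [hi] using hP i
  refine ⟨P, fun i => (P i).dom, fun i => ⟨(P i).isOpen_dom.measurableSet, subset_rfl⟩, ?_, ?_, ?_⟩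
  · intro i j hij
    rw [Set.disjoint_left]
    rintro - ⟨u, hu, rfl⟩ ⟨v, hv, huv⟩
    dsimp only at hu hv
    by_cases hi : i < n
    swap
    · rw [hge i hi] at hu; exact hu
    by_cases hj : j < n
    swap
    · rw [hge j hj] at hv; exact hv
    rw [(hlt i hi).2] at hu
    rw [(hlt j hj).2] at hv
    rw [(hlt i hi).1, (hlt j hj).1] at huv
    obtain ⟨h1, h2, -⟩ := sheet_injective hlam hv hu huv
    exact hij (hinj i hi j hj (Prod.ext h1.symm h2.symm))
  · have hsub : (M lam C D 0) \ ⋃ i, (P i).toFun '' (P i).dom ⊆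
        ⋃ i, (seam lam (e i).1 (e i).2 ∪ degeneratePart lam (e i).1 (e i).2) := by
      rintro q ⟨hq, hq'⟩
      obtain ⟨ε, η, hε, hη, hqε⟩ := exists_sheet_of_mem_M hlam hq
      obtain ⟨i, hi, hei⟩ := hsurj ε η hε hη
      refine Set.mem_iUnion.2 ⟨i, ?_⟩
      rw [hei]
      refine hqε.resolve_left fun h => hq' (Set.mem_iUnion.2 ⟨i, ?_⟩)
      rw [(hlt i hi).1, (hlt i hi).2, hei]
      exact h
    exact measure_mono_null hsub (measure_iUnion_null fun i =>
      measure_union_null (hausdorffMeasure_seam hlam _ _) (hausdorffMeasure_degeneratePart _ _ _))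
  · intro α
    have hz : ∀ i ∉ Finset.range n, (P i).dom = ∅ := fun i hi =>
      hge i fun h => hi (Finset.mem_range.2 h)
    refine ⟨fun i => ?_, ?_, ?_⟩
    · dsimp only
      by_cases hi : i < n
      · rw [(hlt i hi).1, (hlt i hi).2]
        exact hint i hi α
      · rw [hge i hi]
        exact integrableOn_empty
    · exact summable_of_ne_finset_zero (s := Finset.range n) fun i hi => by
        dsimp only
        rw [hz i hi]
        simp
    · have e1 : ∑ i ∈ Finset.range n, sheetIntegral lam (e i).1 (e i).2 α =
          ∑ i ∈ Finset.range n, ∫ u in (P i).dom, pullbackCoeff (P i).toFun α u :=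
        Finset.sum_congr rfl fun i hi => by
          rw [(hlt i (Finset.mem_range.1 hi)).1, (hlt i (Finset.mem_range.1 hi)).2]
          rfl
      simp only [e1]
      exact hasSum_sum_of_ne_finset_zero fun i hi => by
        rw [hz i hi]
        simp

/-! ### Domination and passage to the limit -/

/-- The coefficient of the pullback of `α` under a curve of orbits, as a function of the point
of the curve, its velocity, and the Euler angles. -/
def orbitCoeff (α : TestForm) (x : (Fin 5 → ℝ) × (Fin 5 → ℝ) × (Fin 4 → ℝ)) : ℝ :=
  α.form (orbitMap (x.1, x.2.2)) fun i =>
    fderiv ℝ orbitMap (x.1, x.2.2) ((Pi.single i 1 : Fin 4 → ℝ) 0 • x.2.1, Pi.single i 1)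

lemma continuous_orbitCoeff (α : TestForm) : Continuous (orbitCoeff α) := by
  have h0 : Continuous fun x : (Fin 5 → ℝ) × (Fin 5 → ℝ) × (Fin 4 → ℝ) => (x.1, x.2.2) := by
    fun_prop
  have h1 : Continuous fun x : (Fin 5 → ℝ) × (Fin 5 → ℝ) × (Fin 4 → ℝ) =>
      (α.form (orbitMap (x.1, x.2.2))).toContinuousMultilinearMap :=
    (ContinuousAlternatingMap.isEmbedding_toContinuousMultilinearMap.continuous).comp
      (α.contDiff.continuous.comp (contDiff_orbitMap.continuous.comp h0))
  have h2 : Continuous fun x : (Fin 5 → ℝ) × (Fin 5 → ℝ) × (Fin 4 → ℝ) => fun i : Fin 4 =>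
      fderiv ℝ orbitMap (x.1, x.2.2)
        ((Pi.single i 1 : Fin 4 → ℝ) 0 • x.2.1, (Pi.single i 1 : Fin 4 → ℝ)) := by
    refine continuous_pi fun i => ?_
    refine Continuous.clm_apply
      ((contDiff_orbitMap.continuous_fderiv (by simp)).comp h0) ?_
    fun_prop
  exact h1.eval h2

/-- All dependence on ε and η passes through the curve and its velocity; `orbitCoeff α` is one
continuous function, so bounds and limits of the curve carry over. -/
lemma pullbackCoeff_sheet {lam ε η : ℝ} (hlam : 0 < lam) (α : TestForm) {u : Fin 4 → ℝ}
    (hu : 0 < u 0) : pullbackCoeff (sheet lam ε η) α u =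
      orbitCoeff α (curve lam ε η (u 0), curveDeriv lam ε η (u 0), u) := by
  have h0 : HasFDerivAt (fun u : Fin 4 → ℝ => u 0)
      (ContinuousLinearMap.proj (R := ℝ) (φ := fun _ : Fin 4 => ℝ) 0) u := hasFDerivAt_apply 0 u
  have hc := (hasDerivAt_curve (ε := ε) (η := η) hlam hu).hasFDerivAt
  have h1 := (hc.comp u h0).prodMk (hasFDerivAt_id u)
  have hd : DifferentiableAt ℝ orbitMap (curve lam ε η (u 0), u) :=
    contDiff_orbitMap.differentiable (by simp) _
  have h2 := HasFDerivAt.comp (f := fun u : Fin 4 → ℝ => (curve lam ε η (u 0), u)) u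
    hd.hasFDerivAt h1
  have h3 : fderiv ℝ (sheet lam ε η) u = _ := h2.fderiv
  rw [pullbackCoeff, orbitCoeff]
  congr 1
  ext1 i
  rw [coordTangent, h3]
  simp

lemma continuousOn_pullbackCoeff_sheet {lam : ℝ} (hlam : 0 < lam) (ε η : ℝ) (α : TestForm) :
    ContinuousOn (pullbackCoeff (sheet lam ε η) α) eulerBox := by
  have h1 : ContinuousOn (curve lam ε η) (Set.Ioi 0) := (contDiffOn_curve hlam).continuousOn
  have h2 : ContinuousOn (curveDeriv lam ε η) (Set.Ioi 0) := by
    refine ((contDiffOn_curve (ε := ε) (η := η) hlam).continuousOn_deriv_of_isOpen isOpen_Ioi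
      (by simp)).congr fun t ht => ?_
    exact (hasDerivAt_curve hlam ht).deriv.symm
  have h0 : Set.MapsTo (fun u : Fin 4 → ℝ => u 0) eulerBox (Set.Ioi 0) := fun u hu => hu.1
  have hc : ContinuousOn (fun u : Fin 4 → ℝ => u 0) eulerBox :=
    (continuous_apply 0).continuousOn
  exact ((continuous_orbitCoeff α).comp_continuousOn
    ((h1.comp hc h0).prodMk ((h2.comp hc h0).prodMk continuousOn_id))).congr
    fun u hu => pullbackCoeff_sheet hlam α hu.1

/-- The squared fibre norm is at least √λ t², while the support of the form is bounded. -/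
lemma exists_vanish {lam : ℝ} (hlam : 0 < lam) (α : TestForm) :
    ∃ R, 0 ≤ R ∧ ∀ ε η, ∀ u : Fin 4 → ℝ, 0 < u 0 → R < u 0 →
      pullbackCoeff (sheet lam ε η) α u = 0 := by
  have hq : Continuous fun p : Amb => ∑ k, ∑ l, p.2 k l ^ 2 := by fun_prop
  obtain ⟨B, hB⟩ := α.hasCompactSupport.isCompact.bddAbove_image hq.continuousOn
  have hs := Real.sqrt_pos.2 hlam
  -- The summand 1 makes u 0 exceed 1, so that (u 0)² exceeds u 0.
  refine ⟨1 + |B| / √lam, by positivity, fun ε η u hu hR => ?_⟩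
  have key : α.form (sheet lam ε η u) = 0 := by
    by_contra hne
    have h1 := hB ⟨_, subset_tsupport _ hne, rfl⟩
    have h2 := isSlice_curve (ε := ε) (η := η) hlam hu
    simp only [sheet, orbitMap, sum_sq_act (euler_mem _), sum_sq_slicePoint h2,
      curve_zero_sq hlam hu] at h1
    have h3 := radius_mul_sq_le (lam := lam) (ε := ε) (η := η) (t := u 0) hlam
    have h4 := sqrt_lam_add_le_radius (lam := lam) (ε := ε) (η := η) (t := u 0)
    have h5 : 0 ≤ |B| / √lam := by positivity
    have h6 : |B| / √lam < u 0 ^ 2 := by nlinarith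
    have h7 : |B| < √lam * u 0 ^ 2 := by
      rw [div_lt_iff₀ hs] at h6
      linarith
    have h8 : √lam * u 0 ^ 2 ≤ radius lam ε η (u 0) * u 0 ^ 2 :=
      mul_le_mul_of_nonneg_right (by nlinarith [sq_nonneg (u 0)]) (sq_nonneg _)
    linarith [le_abs_self B, abs_nonneg B]
  rw [pullbackCoeff, key]
  rfl

/-- The majorant is constant on a ball containing the Euler angles and all t ≤ R, and zero outside;
it does not depend on ε and η. -/
lemma exists_bound_pullbackCoeff {lam : ℝ} (hlam : 0 < lam) (α : TestForm) (l δ : ℝ)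
    (hδ : 0 < δ) : ∃ g : (Fin 4 → ℝ) → ℝ, IntegrableOn g eulerBox ∧
      ∀ ε η, |ε| ≤ l → |η| ≤ l → (ε = 0 ∨ δ ≤ |ε|) → ∀ u ∈ eulerBox,
        ‖pullbackCoeff (sheet lam ε η) α u‖ ≤ g u := by
  obtain ⟨R, hR, hvan⟩ := exists_vanish hlam α
  obtain ⟨K, hK⟩ := exists_bound_curve hlam R l δ hδ
  obtain ⟨Z, hZ⟩ : ∃ Z, Z = max R (2 * Real.pi) := ⟨_, rfl⟩
  have hZR : R ≤ Z := hZ ▸ le_max_left _ _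
  have hZpi : 2 * Real.pi ≤ Z := hZ ▸ le_max_right _ _
  have hpi := Real.pi_pos
  obtain ⟨A, hA⟩ := ((isCompact_closedBall (0 : Fin 5 → ℝ) |K|).prod
    ((isCompact_closedBall (0 : Fin 5 → ℝ) |K|).prod
      (isCompact_closedBall (0 : Fin 4 → ℝ) Z))).exists_bound_of_continuousOn
    (continuous_orbitCoeff α).continuousOn
  refine ⟨(Metric.closedBall (0 : Fin 4 → ℝ) Z).indicator fun _ => |A|, ?_,
    fun ε η hε hη hεδ u hu => ?_⟩
  · refine Integrable.integrableOn ?_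
    rw [integrable_indicator_iff Metric.isClosed_closedBall.measurableSet]
    exact integrableOn_const (measure_closedBall_lt_top).ne
  · obtain ⟨h0, ⟨h1, h1'⟩, ⟨h2, h2'⟩, ⟨h3, h3'⟩⟩ := hu
    rcases le_or_gt (u 0) R with hle | hlt
    · have hball : u ∈ Metric.closedBall (0 : Fin 4 → ℝ) Z := by
        rw [mem_closedBall_zero_iff, pi_norm_le_iff_of_nonneg (by linarith)]
        have c0 : -Z ≤ u 0 ∧ u 0 ≤ Z := ⟨by linarith, hle.trans hZR⟩
        have c1 : -Z ≤ u 1 ∧ u 1 ≤ Z := ⟨by linarith, h1'.le.trans hZpi⟩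
        have c2 : -Z ≤ u 2 ∧ u 2 ≤ Z := ⟨by linarith, by linarith⟩
        have c3 : -Z ≤ u 3 ∧ u 3 ≤ Z := ⟨by linarith, h3'.le.trans hZpi⟩
        intro i
        rw [Real.norm_eq_abs, abs_le]
        fin_cases i
        exacts [c0, c1, c2, c3]
      rw [Set.indicator_of_mem hball, pullbackCoeff_sheet hlam α h0]
      obtain ⟨b1, b2⟩ := hK ε η (u 0) hε hη hεδ h0 hle
      refine (hA _ ⟨?_, ?_, hball⟩).trans (le_abs_self A)
      · rw [mem_closedBall_zero_iff, pi_norm_le_iff_of_nonneg (abs_nonneg _)]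
        exact fun i => (b1 i).trans (le_abs_self K)
      · rw [mem_closedBall_zero_iff, pi_norm_le_iff_of_nonneg (abs_nonneg _)]
        exact fun i => (b2 i).trans (le_abs_self K)
    · rw [hvan ε η u h0 hlt, norm_zero]
      exact Set.indicator_nonneg (fun _ _ => abs_nonneg _) _

lemma integrableOn_pullbackCoeff_sheet {lam : ℝ} (hlam : 0 < lam) (ε η : ℝ) (α : TestForm) :
    IntegrableOn (pullbackCoeff (sheet lam ε η) α) eulerBox := by
  obtain ⟨δ, hδ, hε⟩ : ∃ δ, 0 < δ ∧ (ε = 0 ∨ δ ≤ |ε|) := by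
    by_cases h : ε = 0
    · exact ⟨1, one_pos, Or.inl h⟩
    · exact ⟨|ε|, abs_pos.2 h, Or.inr le_rfl⟩
  obtain ⟨g, hg, hb⟩ := exists_bound_pullbackCoeff hlam α (max |ε| |η|) δ hδ
  have hm := isOpen_eulerBox.measurableSet
  refine Integrable.mono' hg
    ((continuousOn_pullbackCoeff_sheet hlam ε η α).aestronglyMeasurable hm) ?_
  exact (ae_restrict_iff' hm).2 (Eventually.of_forall fun u hu =>
    hb ε η (le_max_left _ _) (le_max_right _ _) hε u hu)

/-- The current of a sheet depends continuously on the parameters, as long as `ε` vanishes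
identically or stays away from zero. -/
lemma tendsto_sheetIntegral {lam : ℝ} (hlam : 0 < lam) {e : ℕ → ℝ × ℝ} {e' : ℝ × ℝ}
    (he : Tendsto e atTop (𝓝 e')) (h0 : (∀ j, (e j).1 = 0) ∨ e'.1 ≠ 0) (α : TestForm) :
    Tendsto (fun j => sheetIntegral lam (e j).1 (e j).2 α) atTop
      (𝓝 (sheetIntegral lam e'.1 e'.2 α)) := by
  have h1 : Tendsto (fun j => |(e j).1|) atTop (𝓝 |e'.1|) :=
    ((continuous_fst.tendsto e').comp he).abs
  have h2 : Tendsto (fun j => |(e j).2|) atTop (𝓝 |e'.2|) :=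
    ((continuous_snd.tendsto e').comp he).abs
  obtain ⟨l, hl⟩ : ∃ l, l = max |e'.1| |e'.2| + 1 := ⟨_, rfl⟩
  have hl1 : ∀ᶠ j in atTop, |(e j).1| ≤ l :=
    h1.eventually_le_const (by rw [hl]; linarith [le_max_left |e'.1| |e'.2|])
  have hl2 : ∀ᶠ j in atTop, |(e j).2| ≤ l :=
    h2.eventually_le_const (by rw [hl]; linarith [le_max_right |e'.1| |e'.2|])
  obtain ⟨δ, hδ, hεδ⟩ : ∃ δ, 0 < δ ∧ ∀ᶠ j in atTop, (e j).1 = 0 ∨ δ ≤ |(e j).1| := by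
    rcases h0 with h0 | h0
    · exact ⟨1, one_pos, Eventually.of_forall fun j => Or.inl (h0 j)⟩
    · have := abs_pos.2 h0
      exact ⟨|e'.1| / 2, by positivity,
        (h1.eventually_const_le (by linarith)).mono fun j => Or.inr⟩
  obtain ⟨g, hg, hb⟩ := exists_bound_pullbackCoeff hlam α l δ hδ
  have hm := isOpen_eulerBox.measurableSet
  refine tendsto_integral_filter_of_dominated_convergence g
    (Eventually.of_forall fun j =>
      (continuousOn_pullbackCoeff_sheet hlam _ _ α).aestronglyMeasurable hm) ?_ hg ?_
  · filter_upwards [hl1, hl2, hεδ] with j j1 j2 j3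
    exact (ae_restrict_iff' hm).2 (Eventually.of_forall fun u hu => hb _ _ j1 j2 j3 u hu)
  · refine (ae_restrict_iff' hm).2 (Eventually.of_forall fun u hu => ?_)
    simp only [pullbackCoeff_sheet hlam α hu.1]
    refine ((continuous_orbitCoeff α).tendsto _).comp ?_
    exact (((continuousAt_curve hlam hu.1 e').tendsto.comp he).prodMk_nhds
      (((continuousAt_curveDeriv hlam hu.1 e').tendsto.comp he).prodMk_nhds tendsto_const_nhds))

/-! ### Enumeration of the sheets and conclusion -/

/-- The signed fourth roots of `C` and `D` that parametrize the sheets of `M_{C,D,0}`. -/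
def signedRoots (s : ℕ → ℝ × ℝ) (C D : ℝ) (i : ℕ) : ℝ × ℝ := ((s i).1 * √√C, (s i).2 * √√D)

/-- The signs `s i`, `i < n`, enumerate the pairs of fourth roots of `C` and `D`. -/
structure Enumerates (n : ℕ) (s : ℕ → ℝ × ℝ) (C D : ℝ) : Prop where
  root : ∀ i < n, (signedRoots s C D i).1 ^ 4 = C ∧ (signedRoots s C D i).2 ^ 4 = D
  inj : ∀ i < n, ∀ j < n, signedRoots s C D i = signedRoots s C D j → i = j
  surj : ∀ ε η, ε ^ 4 = C → η ^ 4 = D → ∃ i < n, signedRoots s C D i = (ε, η)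

/-- One list of signs serves all j and the limit, so the finite sums converge term by term. -/
lemma convergesAsCurrents_M {lam : ℝ} (hlam : 0 < lam) {n : ℕ} {s : ℕ → ℝ × ℝ} {C D : ℕ → ℝ}
    {C' D' : ℝ} (hs : ∀ i < n, (s i).1 ≠ 0) (h : ∀ j, Enumerates n s (C j) (D j))
    (h' : Enumerates n s C' D') (hC : Tendsto C atTop (𝓝 C')) (hD : Tendsto D atTop (𝓝 D'))
    (h0 : (∀ j, C j = 0) ∨ 0 < C') :
    ConvergesAsCurrents lam (fun j => M lam (C j) (D j) 0) (M lam C' D' 0) := by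
  have key : ∀ {C D : ℝ}, Enumerates n s C D → IsIntegrationCurrent lam (M lam C D 0)
      fun α => ∑ i ∈ Finset.range n,
        sheetIntegral lam (signedRoots s C D i).1 (signedRoots s C D i).2 α := fun hE =>
    isIntegrationCurrent_M hlam n _ hE.root hE.inj hE.surj
      fun i _ α => integrableOn_pullbackCoeff_sheet hlam _ _ α
  refine ⟨_, _, fun j => key (h j), key h', fun α => tendsto_finsetSum _ fun i hi => ?_⟩
  refine tendsto_sheetIntegral hlam ?_ ?_ α
  · exact (tendsto_const_nhds.mul hC.sqrt.sqrt).prodMk_nhds (tendsto_const_nhds.mul hD.sqrt.sqrt)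
  · refine h0.imp (fun h j => ?_) fun h => ?_
    · simp [signedRoots, h j]
    · exact mul_ne_zero (hs i (Finset.mem_range.1 hi))
        (Real.sqrt_pos.2 (Real.sqrt_pos.2 h)).ne'

lemma sqrt_sqrt_pow_four {C : ℝ} (hC : 0 ≤ C) : √√C ^ 4 = C := by
  calc √√C ^ 4 = (√√C ^ 2) ^ 2 := by ring
    _ = C := by rw [Real.sq_sqrt (Real.sqrt_nonneg _), Real.sq_sqrt hC]

lemma exists_sign_of_pow_four_eq {C ε : ℝ} (h : ε ^ 4 = C) :
    ε = (-1) ^ 0 * √√C ∨ ε = (-1) ^ 1 * √√C := by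
  have e : √√C = |ε| := by
    rw [← h, show ε ^ 4 = (ε ^ 2) ^ 2 by ring, Real.sqrt_sq (sq_nonneg ε), Real.sqrt_sq_eq_abs]
  rw [e]
  rcases abs_cases ε with ⟨h, -⟩ | ⟨h, -⟩ <;> simp [h]

lemma neg_one_pow_mul_pow_four {C : ℝ} (hC : 0 ≤ C) (k : ℕ) : ((-1) ^ k * √√C) ^ 4 = C := by
  rw [mul_pow, sqrt_sqrt_pow_four hC, ← pow_mul, mul_comm k 4, pow_mul]
  norm_num

/-- The two binary digits of i < 4 encode the two signs. -/
lemma enumerates_of_pos {C D : ℝ} (hC : 0 < C) (hD : 0 < D) :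
    Enumerates 4 (fun i => ((-1) ^ (i % 2), (-1) ^ (i / 2))) C D where
  root := fun i _ => ⟨neg_one_pow_mul_pow_four hC.le _, neg_one_pow_mul_pow_four hD.le _⟩
  inj := by
    have hC' := Real.sqrt_pos.2 (Real.sqrt_pos.2 hC)
    have hD' := Real.sqrt_pos.2 (Real.sqrt_pos.2 hD)
    intro i hi j hj h
    obtain ⟨h1, h2⟩ := Prod.ext_iff.1 h
    have h1 := mul_right_cancel₀ hC'.ne' h1
    have h2 := mul_right_cancel₀ hD'.ne' h2
    interval_cases i <;> interval_cases j <;>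
      first | rfl | (exfalso; revert h1 h2; norm_num)
  surj := by
    intro ε η hε hη
    rcases exists_sign_of_pow_four_eq hε with h1 | h1 <;>
      rcases exists_sign_of_pow_four_eq hη with h2 | h2
    · exact ⟨0, by norm_num, Prod.ext h1.symm h2.symm⟩
    · exact ⟨2, by norm_num, Prod.ext h1.symm h2.symm⟩
    · exact ⟨1, by norm_num, Prod.ext h1.symm h2.symm⟩
    · exact ⟨3, by norm_num, Prod.ext h1.symm h2.symm⟩

/-- Zero has a single fourth root, so only one sign varies and there are two sheets. -/
lemma enumerates_zero_right {C : ℝ} (hC : 0 < C) :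
    Enumerates 2 (fun i => ((-1) ^ i, 1)) C 0 where
  root := fun i _ => ⟨neg_one_pow_mul_pow_four hC.le _, by simp [signedRoots]⟩
  inj := by
    have hC' := Real.sqrt_pos.2 (Real.sqrt_pos.2 hC)
    intro i hi j hj h
    have h1 := mul_right_cancel₀ hC'.ne' (Prod.ext_iff.1 h).1
    interval_cases i <;> interval_cases j <;>
      first | rfl | (exfalso; revert h1; norm_num)
  surj := by
    intro ε η hε hη
    have h2 : 1 * √√0 = η := by simpa using (pow_eq_zero_iff (by norm_num)).1 hη |>.symm
    rcases exists_sign_of_pow_four_eq hε with h1 | h1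
    · exact ⟨0, by norm_num, Prod.ext h1.symm h2⟩
    · exact ⟨1, by norm_num, Prod.ext h1.symm h2⟩

lemma enumerates_zero_left {D : ℝ} (hD : 0 < D) :
    Enumerates 2 (fun i => (1, (-1) ^ i)) 0 D where
  root := fun i _ => ⟨by simp [signedRoots], neg_one_pow_mul_pow_four hD.le _⟩
  inj := by
    have hD' := Real.sqrt_pos.2 (Real.sqrt_pos.2 hD)
    intro i hi j hj h
    have h1 := mul_right_cancel₀ hD'.ne' (Prod.ext_iff.1 h).2
    interval_cases i <;> interval_cases j <;>
      first | rfl | (exfalso; revert h1; norm_num)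
  surj := by
    intro ε η hε hη
    have h2 : 1 * √√0 = ε := by simpa using (pow_eq_zero_iff (by norm_num)).1 hε |>.symm
    rcases exists_sign_of_pow_four_eq hη with h1 | h1
    · exact ⟨0, by norm_num, Prod.ext h2 h1.symm⟩
    · exact ⟨1, by norm_num, Prod.ext h2 h1.symm⟩

end

end CoassocSO3

theorem mainTheorem7 (lam : ℝ) (hlam : 0 < lam) :
    (∀ (C D : ℕ → ℝ) (Clim Dlim : ℝ),
      (∀ j, 0 < C j) → (∀ j, 0 < D j) → 0 < Clim → 0 < Dlim →
      Tendsto C atTop (𝓝 Clim) → Tendsto D atTop (𝓝 Dlim) →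
      ((∀ j, √(C j) + √(D j) < √lam) ∨ (∀ j, √lam < √(C j) + √(D j))) →
      √Clim + √Dlim = √lam →
      CoassocSO3.ConvergesAsCurrents lam
        (fun j => CoassocSO3.M lam (C j) (D j) 0) (CoassocSO3.M lam Clim Dlim 0)) ∧
    (∀ (C : ℕ → ℝ) (Clim : ℝ),
      (∀ j, 0 < C j) → Tendsto C atTop (𝓝 Clim) →
      ((∀ j, √(C j) < √lam) ∨ (∀ j, √lam < √(C j))) →
      √Clim = √lam →
      CoassocSO3.ConvergesAsCurrents lam
        (fun j => CoassocSO3.M lam (C j) 0 0) (CoassocSO3.M lam Clim 0 0) ∧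
      CoassocSO3.ConvergesAsCurrents lam
        (fun j => CoassocSO3.M lam 0 (C j) 0) (CoassocSO3.M lam 0 Clim 0)) := by
  refine ⟨fun C D Clim Dlim hC hD hCl hDl hCt hDt _ _ => ?_, fun C Clim hC hCt _ hlim => ?_⟩
  · exact CoassocSO3.convergesAsCurrents_M hlam (fun i _ => by simp)
      (fun j => CoassocSO3.enumerates_of_pos (hC j) (hD j))
      (CoassocSO3.enumerates_of_pos hCl hDl) hCt hDt (Or.inr hCl)
  · have hCl : 0 < Clim := Real.sqrt_pos.1 (hlim ▸ Real.sqrt_pos.2 hlam)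
    exact ⟨CoassocSO3.convergesAsCurrents_M hlam (fun i _ => by simp)
        (fun j => CoassocSO3.enumerates_zero_right (hC j))
        (CoassocSO3.enumerates_zero_right hCl) hCt tendsto_const_nhds (Or.inr hCl),
      -- Here C = 0 for all j, so ε vanishes identically: the other case in which κ is bounded.
      CoassocSO3.convergesAsCurrents_M hlam (fun i _ => by simp)
        (fun j => CoassocSO3.enumerates_zero_left (hC j))
        (CoassocSO3.enumerates_zero_left hCl) tendsto_const_nhds hCt (Or.inl fun _ => rfl)⟩
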